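/- Let $\Sigma$ and $\Delta$ be finite alphabets, and let $\mathrm{conv}(x,y)$ denote the convolution of two words: the shorter word is padded with a blank symbol $\boxdot$ to the length of the longer one, and the symbols at equal positions are paired. Let $\{L_e : e\in I\}$ with $I\subseteq\Delta^*$ be an automatic family of nonempty languages $L_e\subseteq\Sigma^*$, that is, $I$ and $\{\mathrm{conv}(e,x) : e\in I,\ x\in L_e\}$ are regular. A text for $L_e$ is an infinite sequence $w_0,w_1,\dots$ of words whose set of members is $L_e$. A learner reads one datum $w_n$ per cycle, maps (old memory, $w_n$) to (new memory, conjecture), starting from a fixed initial memory, and learns the family if, for all $e\in I$ and all texts for $L_e$, its conjectures are eventually constantly equal to some $d\in I$ with $L_d=L_e$. Theorem. If $\{L_e : e\in I\}$ is learnable, i.e. some learner with a total computable update function (and no restriction on memory or time) learns it, then it is learnt by a linear-time learner with two additional work tapes, i.e. by a deterministic Turing machine with three one-sided infinite tapes, each with an unmodifiable left-end marker $\boxplus$, for which there is a constant $c$ such that the following holds on every sequence $w_0,w_1,\dots$ of words of $\Sigma^*$. Put $\ell_n=\max_{i\le n}|w_i|$. 1. The two work tapes are initially empty, with their heads at the left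 end; their contents and head positions are not changed between cycles, and their length is not restricted. 2. Cycle $n$ starts in the start state, with the base tape containing $\boxplus\,\mathrm{conv}(w_n,m_n)\boxdot\boxdot\cdots$, where $m_n$ is the current long term memory ($m_0$ is a fixed word over a finite alphabet), and with the base head at $\boxplus$; it halts with the base tape starting with $\boxplus\,\mathrm{conv}(e_n,m_{n+1})\boxdot$, where $e_n$ is the conjecture and $m_{n+1}$ the new memory. 3. In cycle $n$ the base head visits only the cell of $\boxplus$ and the $\ell_n+c$ cells to its right; moreover $|m_{n+1}|\le\ell_n+c$ and $|e_n|\le\ell_n+c$. 4. Cycle $n$ takes at most $c\cdot(\max(|w_n|,|m_n|)+1)$ steps; hence its duration is linear in the length $\ell_n$ of the longest datum seen so far. On every text for a language of the family all conjectures $e_n$ belong to $I$. -/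

import Mathlib

/-! ### Automatic families of languages -/

/-- The convolution of two words: the shorter word is padded with `none` (the symbol `⊡`) up to
the length of the longer one, and the symbols at equal positions are paired. -/
def conv {α β : Type} (x : List α) (y : List β) : List (Option α × Option β) :=
  List.zipWithAll Prod.mk x y

/-- The family `{L e : e ∈ I}` is automatic: the index set `I` and the set of all
`conv(e, x)` with `e ∈ I` and `x ∈ L e` are both regular. -/
def IsAutomaticFamily {α β : Type} (I : Language β) (L : List β → Language α) : Prop :=
  I.IsRegular ∧
    Language.IsRegular
      ({z | ∃ e ∈ I, ∃ x ∈ L e, z = conv e x} : Language (Option β × Option α))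

/-! ### Learning in the limit -/

/-- `w` is a text for `S`: it lists all elements of `S`, and nothing else, in any order and with
repetitions allowed. -/
def IsText {α : Type} (w : ℕ → List α) (S : Language α) : Prop :=
  ∀ x : List α, x ∈ S ↔ ∃ n, w n = x

/-- The sequence of conjectures `e` converges syntactically to an index of `S`. -/
def ConvergesToIndexOf {α β : Type} (I : Language β) (L : List β → Language α)
    (e : ℕ → List β) (S : Language α) : Prop :=
  ∃ k, e k ∈ I ∧ L (e k) = S ∧ ∀ k' ≥ k, e k' = e k

/-- The memory, before cycle `n`, of the learner with update function
`U : (old memory, datum) ↦ (new memory, conjecture)` and initial memory `m₀` on the data `w`. -/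
def learnerMemory {α β σ : Type} (U : σ × List α → σ × List β) (m₀ : σ)
    (w : ℕ → List α) : ℕ → σ
  | 0 => m₀
  | n + 1 => (U (learnerMemory U m₀ w n, w n)).1

/-- The conjecture of that learner in cycle `n`. -/
def learnerConjecture {α β σ : Type} (U : σ × List α → σ × List β) (m₀ : σ)
    (w : ℕ → List α) (n : ℕ) : List β :=
  (U (learnerMemory U m₀ w n, w n)).2

/-- The family `{L e : e ∈ I}` is learnable (in the limit, from texts, by a recursive learner
without any restriction on the memory or on the computation time). -/
def IsLearnable {α β : Type} [Primcodable α] [Primcodable β] (I : Language β)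
    (L : List β → Language α) : Prop :=
  ∃ (σ : Type) (_ : Primcodable σ) (U : σ × List α → σ × List β) (m₀ : σ), Computable U ∧
    ∀ e ∈ I, ∀ w : ℕ → List α, IsText w (L e) →
      ConvergesToIndexOf I L (learnerConjecture U m₀ w) (L e)

/-! ### Tapes -/

/-- Head movements. -/
inductive Move
  | left
  | stay
  | right

/-- A one-sided infinite tape. Position `0` carries the left-end marker `⊞`; position `i + 1`
carries the symbol `cells i`. The head is at position `head`. -/
structure WorkTape (Γ : Type) where
  cells : ℕ → Γ
  head : ℕ

namespace WorkTape

/-- The scanned symbol; `none` stands for the left-end marker `⊞`. Hence `⊞` occurs at the left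
end only. -/
def read {Γ : Type} (t : WorkTape Γ) : Option Γ :=
  match t.head with
  | 0 => none
  | i + 1 => some (t.cells i)

/-- Write a symbol into the scanned cell (without effect on `⊞`, which cannot be modified). -/
def write {Γ : Type} (t : WorkTape Γ) (a : Γ) : WorkTape Γ :=
  match t.head with
  | 0 => t
  | i + 1 => { t with cells := Function.update t.cells i a }

/-- Move the head (a move to the left has no effect at the left end). -/
def move {Γ : Type} (t : WorkTape Γ) : Move → WorkTape Γ
  | Move.left => { t with head := t.head - 1 }
  | Move.stay => t
  | Move.right => { t with head := t.head + 1 }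

/-- The tape `⊞ u b b b …` with the head on `⊞`. -/
def ofWord {Γ : Type} (b : Γ) (u : List Γ) : WorkTape Γ where
  cells := fun i => u.getD i b
  head := 0

/-- The content of the tape starts with `⊞ u b`. -/
def StartsWith {Γ : Type} (t : WorkTape Γ) (b : Γ) (u : List Γ) : Prop :=
  ∀ i ≤ u.length, t.cells i = u.getD i b

end WorkTape

/-- Tape symbols (other than `⊞`) of a learner with data alphabet `α`, index alphabet `β`, memory
alphabet `μ` and further symbols `ω`: the blank `⊡`, the symbols of a convolution of datum and
memory, those of a convolution of hypothesis and memory, and the further symbols. -/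
inductive TapeSymbol (α β μ ω : Type) : Type
  | blank
  | input (p : Option α × Option μ)
  | output (p : Option β × Option μ)
  | work (s : ω)

/-! ### Learners with a base tape and additional work tapes -/

/-- A deterministic Turing machine learner with the base tape `0` and the additional work tapes
`1, …, k`. It halts on entering the state `accept`. -/
structure TapeLearner (α β : Type) (k : ℕ) where
  /-- The states. -/
  State : Type
  /-- The alphabet of the long term memory on the base tape. -/
  Mem : Type
  /-- The further tape symbols. -/
  Work : Type
  [finiteState : Finite State]
  [finiteMem : Finite Mem]
  [finiteWork : Finite Work]
  start : State
  accept : State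
  /-- The initial long term memory on the base tape. -/
  initialMemory : List Mem
  /-- The transition function; it reads one symbol per tape (`none` is `⊞`), and yields the next
  state and, per tape, the symbol written and the head movement. -/
  transition : State → (Fin (k + 1) → Option (TapeSymbol α β Mem Work)) →
    State × (Fin (k + 1) → TapeSymbol α β Mem Work × Move)

namespace TapeLearner

variable {α β : Type} {k : ℕ}

/-- The tape alphabet. -/
abbrev Symbol (M : TapeLearner α β k) : Type := TapeSymbol α β M.Mem M.Work

/-- A configuration: the state and the tapes with their head positions. -/
structure Config (M : TapeLearner α β k) where
  state : M.State
  tape : Fin (k + 1) → WorkTape M.Symbol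

/-- One step of the machine. -/
def step (M : TapeLearner α β k) (c : M.Config) : M.Config :=
  let r := M.transition c.state (fun i => (c.tape i).read)
  { state := r.1
    tape := fun i => ((c.tape i).write (r.2 i).1).move (r.2 i).2 }

/-- The configuration at the beginning of a cycle with datum `x`, long term memory `m` and
additional work tapes `T`: the base tape contains `⊞ conv(x, m) ⊡ ⊡ …`, its head is on `⊞`, and
the work tapes are as they were left. -/
def cycleStart (M : TapeLearner α β k) (x : List α) (m : List M.Mem)
    (T : Fin k → WorkTape M.Symbol) : M.Config where
  state := M.start
  tape := Fin.cons
    (WorkTape.ofWord TapeSymbol.blank ((conv x m).map TapeSymbol.input)) T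

/-- The cycle with datum `x`, old memory `m` and old work tapes `T` halts after exactly `t` steps
with the base tape starting with `⊞ conv(e, m') ⊡`, where `e` is the new hypothesis and `m'` the
new memory, and with the work tapes `T'`. -/
def Cycle (M : TapeLearner α β k) (x : List α) (m : List M.Mem)
    (T : Fin k → WorkTape M.Symbol) (t : ℕ) (e : List β) (m' : List M.Mem)
    (T' : Fin k → WorkTape M.Symbol) : Prop :=
  (M.step^[t] (M.cycleStart x m T)).state = M.accept ∧
  (∀ s < t, (M.step^[s] (M.cycleStart x m T)).state ≠ M.accept) ∧
  ((M.step^[t] (M.cycleStart x m T)).tape 0).StartsWith TapeSymbol.blank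
    ((conv e m').map TapeSymbol.output) ∧
  ∀ i : Fin k, (M.step^[t] (M.cycleStart x m T)).tape i.succ = T' i

/-- A run of the learner on the data `w 0, w 1, …`, one datum per cycle; as the machine is
deterministic, there is at most one. Before cycle `n` the memory is `memory n` and the work tapes
are `tapes n`; cycle `n` takes `time n` steps and yields the conjecture `conjecture n`. The work
tapes are empty at first, and neither their contents nor their head positions change between
cycles. -/
structure Run (M : TapeLearner α β k) (w : ℕ → List α) where
  memory : ℕ → List M.Mem
  tapes : ℕ → Fin k → WorkTape M.Symbol
  time : ℕ → ℕ
  conjecture : ℕ → List β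
  memory_zero : memory 0 = M.initialMemory
  tapes_zero : ∀ i, tapes 0 i = WorkTape.ofWord TapeSymbol.blank []
  cycle : ∀ n, M.Cycle (w n) (memory n) (tapes n) (time n) (conjecture n) (memory (n + 1))
    (tapes (n + 1))

end TapeLearner

/-- The length of the longest one among the first `n` data. -/
def longestDatum {α : Type} (w : ℕ → List α) (n : ℕ) : ℕ :=
  (Finset.range n).sup fun i => (w i).length

/-- The resource bounds of a linear-time learner with constant `c`: in each cycle, the number of
steps is linear in the length of the base tape at the beginning of the cycle; the base tape is not
used beyond the length of the longest datum seen so far (including the current one) plus `c`; and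
the same bound holds for the lengths of the new memory and of the conjecture. -/
def TapeLearner.Run.ObeysBounds {α β : Type} {k : ℕ} {M : TapeLearner α β k} {w : ℕ → List α}
    (r : M.Run w) (c : ℕ) : Prop :=
  ∀ n,
    r.time n ≤ c * ((conv (w n) (r.memory n)).length + 1) ∧
    (∀ s ≤ r.time n,
      ((M.step^[s] (M.cycleStart (w n) (r.memory n) (r.tapes n))).tape 0).head ≤
        longestDatum w (n + 1) + c) ∧
    (r.memory (n + 1)).length ≤ longestDatum w (n + 1) + c ∧
    (r.conjecture n).length ≤ longestDatum w (n + 1) + c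

/-- `M` is a linear-time learner which learns the family `{L e : e ∈ I}`: there is a constant such
that, on all data, every cycle halts within the resource bounds; and on each text for a
language of the family, all conjectures are indices and they converge to an index of that
language. -/
def TapeLearner.IsLinearTimeLearnerOf {α β : Type} {k : ℕ} (M : TapeLearner α β k)
    (I : Language β) (L : List β → Language α) : Prop :=
  ∃ c : ℕ, ∀ w : ℕ → List α, ∃ r : M.Run w, r.ObeysBounds c ∧
    ∀ e ∈ I, IsText w (L e) →
      (∀ n, r.conjecture n ∈ I) ∧ ConvergesToIndexOf I L r.conjecture (L e)

/-!
A learnable family has tell-tales: by the locking sequence argument, every `L e` has a finite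
subset `s` such that no `L d` with `s ⊆ L d ⊆ L e` differs from `L e` (`exists_tellTale`). The
original learner plays no further role; the new one relies only on the existence of tell-tales.

The new learner keeps two digit strings, a hypothesis and a challenger, which denote words over the
index alphabet, and it stores all data seen so far on the two work tapes, used as stacks. Rounds of
checking move the stored words one by one from one stack to the other, and test for each of them
whether it belongs to the languages of the hypothesis and of the challenger. At the end of a round
the hypothesis is given up if it missed a word, or if the challenger contains all of them and its
language is a proper subset of that of the hypothesis. The challenger moves on in every round, the
hypothesis whenever it is given up, each of them like an odometer that runs through all digit
strings of the present width. If the hypothesis were given up infinitely often, it would eventually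
pass through an index of the language to be learned when the tell-tale has been seen already; but
such an index is never given up. If it is kept forever, then it contains the language, and the
challengers, which include an index of that language, show that it contains nothing else. This is
`Stage.hyp_converges`.

The width of the digit strings is the length of the longest datum plus a constant. This is enough,
because an index of a language whose words have length at most `N` can be shortened to length
`N + c` without a change of the language, by pumping in the automata of the family
(`exists_short_index`).

As for the running time: membership of a word in the language of an index, proper inclusion of the
languages of two indices, and being an index are regular relations of the words involved, so that
a single finite automaton decides all of them in one sweep over the base tape
(`exists_checker`); in particular inclusion, a statement about all words, costs no more than this.
A checking step handles one word of the stack, which is not longer than the memory is wide. Hence a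
cycle consists of four sweeps over the base tape (`cycle_reaches`), and these cycles compose to a
run of the machine within the bounds (`exists_run`).
-/

/-! ### Words, digit strings and convolutions -/

/-- The word that is denoted by a digit string: its entries before the first `none`. Hence every
word `u` is denoted by all digit strings `u ⊡ v`, whatever `v` is. -/
def decode {γ : Type} : List (Option γ) → List γ
  | [] => []
  | none :: _ => []
  | some a :: l => a :: decode l

theorem decode_append_of_forall_none {γ : Type} (l s : List (Option γ))
    (hs : ∀ a ∈ s, a = none) : decode (l ++ s) = decode l := by
  induction l with
  | nil =>
    cases s with
    | nil => rfl
    | cons a s =>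
      obtain rfl := hs a (by simp)
      rfl
  | cons a l ih => cases a <;> simp [decode, ih]

theorem decode_append_replicate_none {γ : Type} (l : List (Option γ)) (k : ℕ) :
    decode (l ++ List.replicate k none) = decode l :=
  decode_append_of_forall_none _ _ fun _ h => List.eq_of_mem_replicate h

theorem decode_map_some_append_cons_none {γ : Type} (u : List γ) (l : List (Option γ)) :
    decode (u.map some ++ none :: l) = u := by
  induction u with
  | nil => rfl
  | cons a u ih => simp [decode, ih]

theorem decode_map_some {γ : Type} (u : List γ) : decode (u.map some) = u := by
  induction u with
  | nil => rfl
  | cons a u ih => simp [decode, ih]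

theorem decode_map_some_append_replicate {γ : Type} (u : List γ) (k : ℕ) :
    decode (u.map some ++ List.replicate k none) = u := by
  rw [decode_append_replicate_none, decode_map_some]

theorem length_decode_le {γ : Type} (l : List (Option γ)) : (decode l).length ≤ l.length := by
  induction l with
  | nil => simp [decode]
  | cons a l ih => cases a <;> simp [decode, ih]

theorem conv_nil_nil {α β : Type} : conv ([] : List α) ([] : List β) = [] := rfl

theorem conv_cons_nil {α β : Type} (a : α) (x : List α) :
    conv (a :: x) ([] : List β) = (some a, none) :: conv x [] := by
  simp [conv]

theorem conv_nil_cons {α β : Type} (b : β) (y : List β) :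
    conv ([] : List α) (b :: y) = (none, some b) :: conv [] y := rfl

theorem conv_cons_cons {α β : Type} (a : α) (x : List α) (b : β) (y : List β) :
    conv (a :: x) (b :: y) = (some a, some b) :: conv x y := rfl

theorem length_conv {α β : Type} (x : List α) (y : List β) :
    (conv x y).length = max x.length y.length := by
  induction x generalizing y with
  | nil => simp [conv]
  | cons a x ih =>
    cases y with
    | nil => simp [conv]
    | cons b y => simp [conv_cons_cons, ih]

theorem filterMap_fst_conv {α β : Type} (x : List α) (y : List β) :
    (conv x y).filterMap Prod.fst = x := by
  induction x generalizing y with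
  | nil => simp [conv]
  | cons a x ih =>
    cases y with
    | nil => rw [conv_cons_nil]; simp [ih]
    | cons b y => simp [conv_cons_cons, ih]

theorem filterMap_snd_conv {α β : Type} (x : List α) (y : List β) :
    (conv x y).filterMap Prod.snd = y := by
  induction x generalizing y with
  | nil => simp [conv]
  | cons a x ih =>
    cases y with
    | nil => rw [conv_cons_nil]; simp [ih]
    | cons b y => simp [conv_cons_cons, ih]

theorem conv_injective {α β : Type} {x x' : List α} {y y' : List β} (h : conv x y = conv x' y') :
    x = x' ∧ y = y' :=
  ⟨by rw [← filterMap_fst_conv x y, h, filterMap_fst_conv],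
    by rw [← filterMap_snd_conv x y, h, filterMap_snd_conv]⟩

theorem conv_append_of_length_eq {α β : Type} (x x' : List α) (y y' : List β)
    (h : x.length = y.length) : conv (x ++ x') (y ++ y') = conv x y ++ conv x' y' := by
  induction x generalizing y with
  | nil =>
    obtain rfl : y = [] := List.length_eq_zero_iff.1 h.symm
    rfl
  | cons a x ih =>
    cases y with
    | nil => simp at h
    | cons b y =>
      simp only [List.cons_append, conv_cons_cons]
      rw [ih y (by simpa using h)]

theorem conv_append_of_length_le {α β : Type} (x x' : List α) (y : List β)
    (h : y.length ≤ x.length) : conv (x ++ x') y = conv x y ++ conv x' [] := by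
  induction x generalizing y with
  | nil =>
    obtain rfl : y = [] := List.length_eq_zero_iff.1 (by simpa using h)
    rfl
  | cons a x ih =>
    cases y with
    | nil =>
      simp only [List.cons_append, conv_cons_nil]
      rw [ih [] (by simp)]
    | cons b y =>
      simp only [List.cons_append, conv_cons_cons]
      rw [ih y (by simpa using h)]

/-! ### Closure properties of regular languages -/

theorem isRegular_preimage_map {T T' : Type} {P : Language T'} (hP : P.IsRegular) (f : T → T') :
    Language.IsRegular ({z | z.map f ∈ P} : Language T) := by
  obtain ⟨σ, hσ, M, rfl⟩ := hP
  exact ⟨σ, hσ, M.comap f, by rw [DFA.accepts_comap]; rfl⟩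

open Classical in
/-- Regular languages are closed under letter-to-letter homomorphisms; the automaton for the image
keeps track of the set of states that are reached on some preimage. -/
theorem isRegular_image_map {T T' : Type} {P : Language T} (hP : P.IsRegular) (f : T → T') :
    Language.IsRegular ({u | ∃ z ∈ P, z.map f = u} : Language T') := by
  obtain ⟨σ, hσ, M, rfl⟩ := hP
  let D : DFA T' (Set σ) :=
    { step := fun S a => {q' | ∃ q ∈ S, ∃ t, f t = a ∧ M.step q t = q'}
      start := {M.start}
      accept := {S | ∃ q ∈ S, q ∈ M.accept} }
  have key : ∀ (u : List T') (S : Set σ) (q' : σ),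
      q' ∈ D.evalFrom S u ↔ ∃ q ∈ S, ∃ z : List T, z.map f = u ∧ M.evalFrom q z = q' := by
    intro u
    induction u with
    | nil =>
      intro S q'
      simp
    | cons a u ih =>
      intro S q'
      rw [DFA.evalFrom_cons, ih]
      constructor
      · rintro ⟨q, ⟨p, hp, t, rfl, rfl⟩, z, rfl, rfl⟩
        exact ⟨p, hp, t :: z, rfl, rfl⟩
      · rintro ⟨p, hp, z, hz, rfl⟩
        cases z with
        | nil => simp at hz
        | cons t z =>
          simp only [List.map_cons, List.cons.injEq] at hz
          obtain ⟨rfl, rfl⟩ := hz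
          exact ⟨_, ⟨p, hp, t, rfl, rfl⟩, z, rfl, rfl⟩
  refine ⟨Set σ, inferInstance, D, ?_⟩
  ext u
  change (∃ q ∈ D.evalFrom {M.start} u, q ∈ M.accept) ↔ _
  simp only [key, Set.mem_singleton_iff, exists_eq_left]
  constructor
  · rintro ⟨_, ⟨z, rfl, rfl⟩, h⟩
    exact ⟨z, h, rfl⟩
  · rintro ⟨z, h, rfl⟩
    exact ⟨_, ⟨z, rfl, rfl⟩, h⟩

theorem isRegular_rightQuotient {T : Type} {P : Language T} (hP : P.IsRegular)
    (S : Set (List T)) : Language.IsRegular ({u | ∃ s ∈ S, u ++ s ∈ P} : Language T) := by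
  obtain ⟨σ, hσ, M, rfl⟩ := hP
  refine ⟨σ, hσ, ⟨M.step, M.start, {q | ∃ s ∈ S, M.evalFrom q s ∈ M.accept}⟩, ?_⟩
  ext u
  change (∃ s ∈ S, M.evalFrom (M.evalFrom M.start u) s ∈ M.accept) ↔
    ∃ s ∈ S, M.evalFrom M.start (u ++ s) ∈ M.accept
  simp only [DFA.evalFrom_of_append]

theorem isRegular_decode_mem {β : Type} {I : Language β} (hI : I.IsRegular) :
    Language.IsRegular ({v | decode v ∈ I} : Language (Option β)) := by
  obtain ⟨σ, hσ, M, rfl⟩ := hI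
  -- The second component of a state tells whether no `none` has been read yet.
  let D : DFA (Option β) (σ × Bool) :=
    { step := fun s o =>
        match s.2, o with
        | true, some b => (M.step s.1 b, true)
        | _, _ => (s.1, false)
      start := (M.start, true)
      accept := {s | s.1 ∈ M.accept} }
  have h1 : ∀ (v : List (Option β)) (q : σ), (D.evalFrom (q, false) v).1 = q := by
    intro v
    induction v with
    | nil => intro q; rfl
    | cons o v ih =>
      intro q
      rw [DFA.evalFrom_cons]
      exact ih q
  have h2 : ∀ (v : List (Option β)) (q : σ),
      (D.evalFrom (q, true) v).1 = M.evalFrom q (decode v) := by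
    intro v
    induction v with
    | nil => intro q; rfl
    | cons o v ih =>
      intro q
      rw [DFA.evalFrom_cons]
      cases o with
      | none => exact h1 v q
      | some b => exact ih _
  refine ⟨σ × Bool, inferInstance, D, ?_⟩
  ext v
  change (D.evalFrom (M.start, true) v).1 ∈ M.accept ↔ _
  rw [h2]
  rfl

theorem isRegular_conv_decode_mem {α β : Type} {J : Language (Option β × Option α)}
    (hJ : J.IsRegular) :
    Language.IsRegular ({z | conv (decode (z.map Prod.fst)) (decode (z.map Prod.snd)) ∈ J} :
      Language (Option β × Option α)) := by
  obtain ⟨σ, hσ, M, rfl⟩ := hJ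
  -- The Boolean components of a state tell which of the two words have not ended yet.
  let D : DFA (Option β × Option α) (σ × Bool × Bool) :=
    { step := fun s o =>
        match (if s.2.1 then o.1 else none), (if s.2.2 then o.2 else none) with
        | none, none => (s.1, false, false)
        | p, p' => (M.step s.1 (p, p'), p.isSome, p'.isSome)
      start := (M.start, true, true)
      accept := {s | s.1 ∈ M.accept} }
  have key : ∀ (z : List (Option β × Option α)) (q : σ) (b b' : Bool),
      (D.evalFrom (q, b, b') z).1 =
        M.evalFrom q (conv (if b then decode (z.map Prod.fst) else [])
          (if b' then decode (z.map Prod.snd) else [])) := by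
    intro z
    induction z with
    | nil => intro q b b'; cases b <;> cases b' <;> rfl
    | cons o z ih =>
      intro q b b'
      rw [DFA.evalFrom_cons]
      obtain ⟨o, o'⟩ := o
      cases b <;> cases b' <;> cases o <;> cases o' <;>
        simp [D, decode, ih, conv_nil_nil, conv_cons_nil, conv_nil_cons, conv_cons_cons]
  refine ⟨σ × Bool × Bool, inferInstance, D, ?_⟩
  ext v
  change (D.evalFrom (M.start, true, true) v).1 ∈ M.accept ↔ _
  rw [key]
  rfl

/-! ### The languages of an automatic family -/

/-- The language with index `e` in the family that is given by the set `J` of convolutions. -/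
def fiber {α β : Type} (J : Language (Option β × Option α)) (e : List β) : Set (List α) :=
  {x | conv e x ∈ J}

theorem isRegular_fiber_subset {α β : Type} {J : Language (Option β × Option α)}
    (hJ : J.IsRegular) :
    Language.IsRegular ({z | fiber J (decode (z.map Prod.fst)) ⊆ fiber J (decode (z.map Prod.snd))} :
      Language (Option β × Option β)) := by
  have h1 := isRegular_preimage_map (isRegular_conv_decode_mem hJ)
    (fun t : Option β × Option β × Option α => (t.1, t.2.2))
  have h2 := isRegular_preimage_map (isRegular_conv_decode_mem hJ)
    (fun t : Option β × Option β × Option α => (t.2.1, t.2.2))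
  have h3 := isRegular_image_map (isRegular_rightQuotient (h1.inf h2.compl)
    {s | ∀ t ∈ s, t.1 = none ∧ t.2.1 = none})
    (fun t : Option β × Option β × Option α => (t.1, t.2.1))
  suffices h : ({z | fiber J (decode (z.map Prod.fst)) ⊆ fiber J (decode (z.map Prod.snd))} :
      Language (Option β × Option β)) = _ by
    rw [h]
    exact h3.compl
  ext z
  refine Iff.trans ?_ (not_congr (Iff.refl
    (∃ y : List (Option β × Option β × Option α),
      (∃ s : List (Option β × Option β × Option α), (∀ t ∈ s, t.1 = none ∧ t.2.1 = none) ∧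
        conv (decode (((y ++ s).map (fun t => (t.1, t.2.2))).map Prod.fst))
          (decode (((y ++ s).map (fun t => (t.1, t.2.2))).map Prod.snd)) ∈ J ∧
        ¬ conv (decode (((y ++ s).map (fun t => (t.2.1, t.2.2))).map Prod.fst))
          (decode (((y ++ s).map (fun t => (t.2.1, t.2.2))).map Prod.snd)) ∈ J) ∧
      y.map (fun t => (t.1, t.2.1)) = z)))
  change (∀ x, conv _ x ∈ J → conv _ x ∈ J) ↔ _
  -- Appending blank digits to a digit string does not change the denoted word.
  have e1 : ∀ y s : List (Option β × Option β × Option α), (∀ t ∈ s, t.1 = none ∧ t.2.1 = none) →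
      decode (((y ++ s).map (fun t => (t.1, t.2.2))).map Prod.fst) =
        decode ((y.map (fun t => (t.1, t.2.1))).map Prod.fst) := by
    intro y s hs
    simp only [List.map_map, List.map_append]
    refine decode_append_of_forall_none _ _ fun a ha => ?_
    obtain ⟨t, ht, rfl⟩ := List.mem_map.1 ha
    exact (hs t ht).1
  have e2 : ∀ y s : List (Option β × Option β × Option α), (∀ t ∈ s, t.1 = none ∧ t.2.1 = none) →
      decode (((y ++ s).map (fun t => (t.2.1, t.2.2))).map Prod.fst) =
        decode ((y.map (fun t => (t.1, t.2.1))).map Prod.snd) := by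
    intro y s hs
    simp only [List.map_map, List.map_append]
    refine decode_append_of_forall_none _ _ fun a ha => ?_
    obtain ⟨t, ht, rfl⟩ := List.mem_map.1 ha
    exact (hs t ht).2
  constructor
  · rintro h ⟨y, ⟨s, hs, ha, hb⟩, rfl⟩
    rw [e1 y s hs] at ha
    rw [e2 y s hs] at hb
    simp only [List.map_map] at ha hb h
    exact hb (h _ ha)
  · intro h x hx
    by_contra hx'
    apply h
    -- The word `x` is padded to a length of at least `z.length`.
    let p : List (Option α) := x.map some ++ List.replicate z.length none
    have hp : z.length ≤ p.length := by simp [p]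
    let y : List (Option β × Option β × Option α) :=
      (z.zip (p.take z.length)).map (fun t => (t.1.1, t.1.2, t.2))
    let s : List (Option β × Option β × Option α) :=
      (p.drop z.length).map (fun b => (none, none, b))
    have hlen : z.length = (p.take z.length).length := by simp [hp]
    have hy1 : y.map (fun t => (t.1, t.2.1)) = z := by
      simp only [y, List.map_map]
      exact List.map_fst_zip hlen.le
    have hs : ∀ t ∈ s, t.1 = none ∧ t.2.1 = none := by
      intro t ht
      obtain ⟨b, _, rfl⟩ := List.mem_map.1 ht
      simp
    have hy2 : decode ((y ++ s).map (fun t => t.2.2)) = x := by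
      have h1 : y.map (fun t => t.2.2) = p.take z.length := by
        simp only [y, List.map_map]
        exact List.map_snd_zip hlen.ge
      have h2 : s.map (fun t => t.2.2) = p.drop z.length := by
        simp [s, Function.comp_def]
      rw [List.map_append, h1, h2, List.take_append_drop]
      exact decode_map_some_append_replicate _ _
    refine ⟨y, ⟨s, hs, ?_, ?_⟩, hy1⟩
    · rw [e1 y s hs, hy1, List.map_map]
      simpa only [Function.comp_def, hy2] using hx
    · rw [e2 y s hs, hy1, List.map_map]
      simpa only [Function.comp_def, hy2] using hx'

theorem isRegular_fiber_ssubset {α β : Type} {J : Language (Option β × Option α)}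
    (hJ : J.IsRegular) :
    Language.IsRegular ({z | fiber J (decode (z.map Prod.fst)) ⊂ fiber J (decode (z.map Prod.snd))} :
      Language (Option β × Option β)) := by
  have h := isRegular_preimage_map (isRegular_fiber_subset hJ) (Prod.swap (α := Option β))
  suffices h' : ({z | fiber J (decode (z.map Prod.fst)) ⊂ fiber J (decode (z.map Prod.snd))} :
      Language (Option β × Option β)) = _ by
    rw [h']
    exact (isRegular_fiber_subset hJ).inf h.compl
  ext z
  change _ ↔ fiber J _ ⊆ fiber J _ ∧ ¬ (fiber J (decode ((z.map Prod.swap).map Prod.fst)) ⊆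
    fiber J (decode ((z.map Prod.swap).map Prod.snd)))
  simp only [List.map_map]
  exact Iff.rfl

/-- An index of a finite language can be chosen almost as short as the longest word: what
automata can notice of the part of the index beyond that length is bounded. -/
theorem exists_short_index {α β : Type} {I : Language β} {J : Language (Option β × Option α)}
    (hI : I.IsRegular) (hJ : J.IsRegular) :
    ∃ c : ℕ, ∀ e ∈ I, ∀ N : ℕ, (∀ x ∈ fiber J e, x.length ≤ N) →
      ∃ d ∈ I, fiber J d = fiber J e ∧ d.length ≤ N + c := by
  classical
  obtain ⟨σ, hσ, M, rfl⟩ := hI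
  obtain ⟨τ, hτ, D, rfl⟩ := hJ
  -- `F s` records how the two automata treat `s` as the last part of an index.
  let F : List β → (σ → Prop) × (τ → Prop) × (τ → Prop) := fun s =>
    (fun q => M.evalFrom q s ∈ M.accept, fun q => D.evalFrom q (conv s []) ∈ D.accept,
      fun q => ∃ y ≠ [], D.evalFrom q (conv s y) ∈ D.accept)
  have hfin : (Set.range F).Finite := Set.toFinite _
  have hrep : ∀ v ∈ Set.range F, ∃ s, F s = v := fun v hv => hv
  choose! rep hrep using hrep
  refine ⟨hfin.toFinset.sup fun v => (rep v).length, fun e he N hN => ?_⟩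
  by_cases hle : e.length ≤ N
  · exact ⟨e, he, rfl, by omega⟩
  have hFs : F (rep (F (e.drop N))) = F (e.drop N) := hrep _ ⟨_, rfl⟩
  have hlen : (rep (F (e.drop N))).length ≤ hfin.toFinset.sup fun v => (rep v).length :=
    Finset.le_sup (f := fun v => (rep v).length) (hfin.mem_toFinset.2 ⟨_, rfl⟩)
  generalize rep (F (e.drop N)) = s at hFs hlen
  have h0 : (e.take N).length = N := by simp; omega
  have h1 : ∀ q, M.evalFrom q s ∈ M.accept ↔ M.evalFrom q (e.drop N) ∈ M.accept := fun q =>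
    iff_of_eq (congrFun (congrArg Prod.fst hFs) q)
  have h2 : ∀ q, D.evalFrom q (conv s []) ∈ D.accept ↔
      D.evalFrom q (conv (e.drop N) []) ∈ D.accept := fun q =>
    iff_of_eq (congrFun (congrArg (fun v => v.2.1) hFs) q)
  have h3 : ∀ q, (∃ y ≠ [], D.evalFrom q (conv s y) ∈ D.accept) ↔
      ∃ y ≠ [], D.evalFrom q (conv (e.drop N) y) ∈ D.accept := fun q =>
    iff_of_eq (congrFun (congrArg (fun v => v.2.2) hFs) q)
  have hshort : ∀ (t : List β) (x : List α), x.length ≤ N →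
      (x ∈ fiber D.accepts (e.take N ++ t) ↔
        D.evalFrom (D.evalFrom D.start (conv (e.take N) x)) (conv t []) ∈ D.accept) := by
    intro t x hx
    change D.evalFrom D.start (conv (e.take N ++ t) x) ∈ D.accept ↔ _
    rw [conv_append_of_length_le _ _ _ (by omega), DFA.evalFrom_of_append]
  have hlong : ∀ (t : List β) (x y : List α), x.length = N →
      (x ++ y ∈ fiber D.accepts (e.take N ++ t) ↔
        D.evalFrom (D.evalFrom D.start (conv (e.take N) x)) (conv t y) ∈ D.accept) := by
    intro t x y hx
    change D.evalFrom D.start (conv (e.take N ++ t) (x ++ y)) ∈ D.accept ↔ _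
    rw [conv_append_of_length_eq _ _ _ _ (by omega), DFA.evalFrom_of_append]
  have hsplit : fiber D.accepts e = fiber D.accepts (e.take N ++ e.drop N) := by
    rw [List.take_append_drop]
  refine ⟨e.take N ++ s, ?_, ?_, by rw [List.length_append, h0]; omega⟩
  · change M.evalFrom M.start (e.take N ++ s) ∈ M.accept
    rw [DFA.evalFrom_of_append, h1, ← DFA.evalFrom_of_append, List.take_append_drop]
    exact he
  · rw [hsplit] at hN ⊢
    ext x
    by_cases hx : x.length ≤ N
    · rw [hshort _ _ hx, hshort _ _ hx, h2]
    · refine ⟨fun h => ?_, fun h => absurd (hN x h) hx⟩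
      exfalso
      have hxs : x = x.take N ++ x.drop N := (List.take_append_drop N x).symm
      have hx0 : (x.take N).length = N := by simp; omega
      rw [hxs, hlong _ _ _ hx0] at h
      obtain ⟨y, hy, hy'⟩ := (h3 _).1 ⟨x.drop N, by simp; omega, h⟩
      rw [← hlong _ _ _ hx0] at hy'
      have := hN _ hy'
      have := List.length_pos_iff.2 hy
      simp at *
      omega

/-! ### Tell-tale sets -/

theorem learnerMemory_eq_foldl {α β σ : Type} (U : σ × List α → σ × List β) (m₀ : σ)
    (w : ℕ → List α) (s : List (List α)) (hs : ∀ i < s.length, s[i]? = some (w i)) :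
    learnerMemory U m₀ w s.length = s.foldl (fun m x => (U (m, x)).1) m₀ := by
  induction s using List.reverseRecOn with
  | nil => rfl
  | append_singleton s x ih =>
    have h1 : ∀ i < s.length, s[i]? = some (w i) := by
      intro i hi
      rw [← hs i (by simp; omega), List.getElem?_append_left hi]
    have h2 : w s.length = x := by
      have := hs s.length (by simp)
      simpa using this.symm
    rw [List.length_append, List.length_singleton, learnerMemory, ih h1, h2, List.foldl_append]
    rfl

theorem learnerConjecture_length {α β σ : Type} (U : σ × List α → σ × List β) (m₀ : σ)
    (w : ℕ → List α) (s : List (List α)) (x : List α)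
    (hs : ∀ i < (s ++ [x]).length, (s ++ [x])[i]? = some (w i)) :
    learnerConjecture U m₀ w s.length = (U (s.foldl (fun m x => (U (m, x)).1) m₀, x)).2 := by
  have h1 : ∀ i < s.length, s[i]? = some (w i) := by
    intro i hi
    rw [← hs i (by simp; omega), List.getElem?_append_left hi]
  have h2 : w s.length = x := by
    have := hs s.length (by simp)
    simpa using this.symm
  rw [learnerConjecture, learnerMemory_eq_foldl U m₀ w s h1, h2]

/-- A chain of finite sequences, each a proper extension of the preceding one, has a limit. -/
theorem exists_limit_of_prefix {X : Type} (S : ℕ → List X) (hp : ∀ k, S k <+: S (k + 1))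
    (hl : ∀ k, k ≤ (S k).length) :
    ∃ w : ℕ → X, ∀ k, ∀ i < (S k).length, (S k)[i]? = some (w i) := by
  have hmono : ∀ k k', k ≤ k' → S k <+: S k' := by
    intro k k' h
    induction h with
    | refl => exact List.prefix_rfl
    | step _ ih => exact ih.trans (hp _)
  have hget : ∀ k k' i, k ≤ k' → i < (S k).length → (S k')[i]? = (S k)[i]? := by
    intro k k' i h hi
    obtain ⟨t, ht⟩ := hmono k k' h
    rw [← ht, List.getElem?_append_left hi]
  have hlt : ∀ n, n < (S (n + 1)).length := fun n => hl (n + 1)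
  refine ⟨fun n => (S (n + 1))[n]'(hlt n), fun k i hi => ?_⟩
  change _ = some ((S (i + 1))[i]'(hlt i))
  rw [← List.getElem?_eq_getElem]
  rcases le_total k (i + 1) with h | h
  · exact (hget _ _ _ h hi).symm
  · exact hget _ _ _ h (hlt i)

/-- Blum and Blum's locking sequence: on some finite sequence of members of the language the
learner conjectures a correct index which no further members make it change. -/
theorem exists_lockingSequence {α β σ : Type} [Countable α] (I : Language β)
    (L : List β → Language α) (U : σ × List α → σ × List β) (m₀ : σ) (e : List β)
    (hne : ∃ x : List α, x ∈ L e)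
    (hU : ∀ w : ℕ → List α, IsText w (L e) →
      ConvergesToIndexOf I L (learnerConjecture U m₀ w) (L e)) :
    ∃ (s : List (List α)) (v : List β), (∀ x ∈ s, x ∈ L e) ∧ L v = L e ∧
      ∀ (t : List (List α)) (y : List α), (∀ x ∈ t, x ∈ L e) → y ∈ L e →
        (U ((s ++ t).foldl (fun m x => (U (m, x)).1) m₀, y)).2 = v := by
  by_contra hcon
  push Not at hcon
  let C : List (List α) → List α → List β := fun s x =>
    (U (s.foldl (fun m x => (U (m, x)).1) m₀, x)).2
  have hstep : ∀ (s : List (List α)) (x : List α), ∃ (t : List (List α)) (y : List α),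
      (∀ z ∈ s, z ∈ L e) → x ∈ L e → (∀ z ∈ t, z ∈ L e) ∧ y ∈ L e ∧
        (L (C s x) = L e → C (s ++ x :: t) y ≠ C s x) := by
    intro s x
    by_cases h : (∀ z ∈ s, z ∈ L e) ∧ x ∈ L e ∧ L (C s x) = L e
    · obtain ⟨t, y, ht, hy, hty⟩ := hcon (s ++ [x]) (C s x)
        (by simpa [or_imp, forall_and] using ⟨h.1, h.2.1⟩) h.2.2
      refine ⟨t, y, fun _ _ => ⟨ht, hy, fun _ => ?_⟩⟩
      simpa [C] using hty
    · exact ⟨[], x, fun h1 h2 => ⟨by simp, h2, fun h3 => absurd ⟨h1, h2, h3⟩ h⟩⟩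
  choose t y hty using hstep
  obtain ⟨f, hf⟩ := (Set.to_countable {x | x ∈ L e}).exists_eq_range hne
  have hfL : ∀ k, f k ∈ L e := fun k => (Set.ext_iff.1 hf _).2 ⟨k, rfl⟩
  -- The text enumerates the language, and after each new element it makes the learner change its
  -- conjecture, if that is correct.
  let S : ℕ → List (List α) := fun k =>
    Nat.rec [] (fun k s => s ++ [f k] ++ t s (f k) ++ [y s (f k)]) k
  have hS : ∀ k, S (k + 1) = S k ++ [f k] ++ t (S k) (f k) ++ [y (S k) (f k)] := fun k => rfl
  have hSL : ∀ k, ∀ x ∈ S k, x ∈ L e := by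
    intro k
    induction k with
    | zero => simp [S]
    | succ k ih =>
      obtain ⟨h1, h2, -⟩ := hty (S k) (f k) ih (hfL k)
      intro x hx
      rw [hS] at hx
      simp only [List.mem_append, List.mem_singleton] at hx
      rcases hx with ((hx | rfl) | hx) | rfl
      exacts [ih x hx, hfL k, h1 x hx, h2]
  have hlen : ∀ k, k ≤ (S k).length := by
    intro k
    induction k with
    | zero => simp
    | succ k ih => rw [hS]; simp; omega
  obtain ⟨w, hw⟩ := exists_limit_of_prefix S (fun k => ⟨_, by rw [hS, List.append_assoc,
    List.append_assoc]⟩) hlen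
  have hwL : ∀ n, w n ∈ L e := fun n =>
    hSL (n + 1) _ (List.mem_of_getElem? (hw (n + 1) n (hlen (n + 1))))
  have htext : IsText w (L e) := by
    intro x
    constructor
    · intro hx
      obtain ⟨k, rfl⟩ := (Set.ext_iff.1 hf x).1 hx
      refine ⟨(S k).length, ?_⟩
      have := hw (k + 1) (S k).length (by simp [hS])
      rw [hS] at this
      simpa using this.symm
    · rintro ⟨n, rfl⟩
      exact hwL n
  obtain ⟨k, -, hk, hk'⟩ := hU w htext
  have h1 : learnerConjecture U m₀ w (S k).length = C (S k) (f k) := by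
    refine learnerConjecture_length U m₀ w (S k) (f k) fun i hi => ?_
    rw [← hw (k + 1) i (by rw [hS]; simp at hi ⊢; omega), hS, List.append_assoc,
      List.getElem?_append_left hi]
  have h2 : learnerConjecture U m₀ w (S k ++ f k :: t (S k) (f k)).length =
      C (S k ++ f k :: t (S k) (f k)) (y (S k) (f k)) := by
    refine learnerConjecture_length U m₀ w _ _ fun i hi => ?_
    have hS' : S (k + 1) = S k ++ f k :: t (S k) (f k) ++ [y (S k) (f k)] := by
      rw [hS]; simp
    rw [← hS'] at hi ⊢
    exact hw (k + 1) i hi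
  have h3 := hk' _ (hlen k)
  have h4 := hk' (S k ++ f k :: t (S k) (f k)).length (by
    have := hlen k
    simp
    omega)
  refine (hty (S k) (f k) (hSL k) (hfL k)).2.2 ?_ ?_
  · rw [← h1, h3, hk]
  · rw [← h2, h4, ← h3, h1]

/-- Angluin's condition: each language of a learnable family has a finite subset that lies in no
properly smaller language of the family. -/
theorem exists_tellTale {α β σ : Type} [Countable α] (I : Language β)
    (L : List β → Language α) (hne : ∀ e ∈ I, ∃ x : List α, x ∈ L e)
    (U : σ × List α → σ × List β) (m₀ : σ)
    (hU : ∀ e ∈ I, ∀ w : ℕ → List α, IsText w (L e) →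
      ConvergesToIndexOf I L (learnerConjecture U m₀ w) (L e)) (e : List β) (he : e ∈ I) :
    ∃ s : List (List α), (∀ x ∈ s, x ∈ L e) ∧
      ∀ d ∈ I, (∀ x ∈ s, x ∈ L d) → (∀ x ∈ L d, x ∈ L e) → L d = L e := by
  obtain ⟨s, v, hs, hv, hlock⟩ := exists_lockingSequence I L U m₀ e (hne e he) (hU e he)
  refine ⟨s, hs, fun d hd hsd hde => ?_⟩
  obtain ⟨f, hf⟩ := (Set.to_countable {x | x ∈ L d}).exists_eq_range (hne d hd)
  have hfL : ∀ k, f k ∈ L d := fun k => (Set.ext_iff.1 hf _).2 ⟨k, rfl⟩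
  let w : ℕ → List α := fun n => if h : n < s.length then s[n] else f (n - s.length)
  have hw : ∀ j, ∀ i < (s ++ (List.range j).map f).length,
      (s ++ (List.range j).map f)[i]? = some (w i) := by
    intro j i hi
    by_cases h : i < s.length
    · rw [List.getElem?_append_left h]
      simp [w, h]
    · rw [List.getElem?_append_right (by omega)]
      simp only [List.length_append, List.length_map, List.length_range] at hi
      simp [w, h, List.getElem?_range (show i - s.length < j by omega)]
  have htext : IsText w (L d) := by
    intro x
    constructor
    · intro hx
      obtain ⟨k, rfl⟩ := (Set.ext_iff.1 hf x).1 hx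
      exact ⟨s.length + k, by simp [w]⟩
    · rintro ⟨n, rfl⟩
      by_cases h : n < s.length
      · simp only [w, h, dite_true]
        exact hsd _ (List.getElem_mem h)
      · simp only [w, h, dite_false]
        exact hfL _
  obtain ⟨k, -, hk, hk'⟩ := hU d hd w htext
  have h1 : learnerConjecture U m₀ w (s ++ (List.range k).map f).length = v := by
    rw [learnerConjecture_length U m₀ w _ (f k)]
    · refine hlock _ _ (fun x hx => ?_) (hde _ (hfL k))
      obtain ⟨i, -, rfl⟩ := List.mem_map.1 hx
      exact hde _ (hfL i)
    · have := hw (k + 1)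
      rwa [List.range_succ, List.map_append, ← List.append_assoc] at this
  have h2 := hk' (s ++ (List.range k).map f).length (by simp)
  rw [← hk, ← h2, h1, hv]

/-! ### The odometer on digit strings -/

/-- An enumeration of the digits. -/
noncomputable def digitEquiv (β : Type) [Fintype β] : Option β ≃ Fin (Fintype.card β + 1) :=
  Fintype.equivFinOfCardEq Fintype.card_option

/-- The cyclic successor of a digit. -/
noncomputable def nextDigit {β : Type} [Fintype β] (a : Option β) : Option β :=
  (digitEquiv β).symm (digitEquiv β a + 1)

/-- Passing from `a` to its successor causes a carry. -/
noncomputable def carries {β : Type} [Fintype β] (a : Option β) : Bool :=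
  decide (digitEquiv β a = Fin.last _)

/-- If the incoming carry `b` is set, advance the odometer by one; its least significant digit is
the leftmost one, and an overflow is ignored. As carries run to the right, an initial segment of
the odometer is an odometer again, even if digits are appended on the right in between. -/
noncomputable def advance {β : Type} [Fintype β] (b : Bool) : List (Option β) → List (Option β)
  | [] => []
  | a :: v => (if b then nextDigit a else a) :: advance (b && carries a) v

section Odometer

variable {β : Type} [Fintype β]

theorem length_advance (b : Bool) (v : List (Option β)) : (advance b v).length = v.length := by
  induction v generalizing b with
  | nil => rfl
  | cons a v ih => simp [advance, ih]

theorem advance_false (v : List (Option β)) : advance false v = v := by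
  induction v with
  | nil => rfl
  | cons a v ih => simp [advance, ih]

theorem take_advance (k : ℕ) (b : Bool) (v : List (Option β)) :
    (advance b v).take k = advance b (v.take k) := by
  induction v generalizing b k with
  | nil => simp [advance]
  | cons a v ih => cases k <;> simp [advance, ih]

theorem advance_reaches_digit (v : List (Option β)) (i j : ℕ) (hij : i ≤ j)
    (hj : j < Fintype.card β + 1) :
    Relation.ReflTransGen (fun u u' => u' = advance true u)
      ((digitEquiv β).symm ⟨i, by omega⟩ :: v) ((digitEquiv β).symm ⟨j, hj⟩ :: v) := by
  induction j, hij using Nat.le_induction with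
  | base => exact .refl
  | succ j hij ih =>
    refine (ih (by omega)).tail ?_
    have h1 : carries ((digitEquiv β).symm ⟨j, by omega⟩) = false := by
      simp [carries, Fin.ext_iff]
      omega
    have h2 : nextDigit ((digitEquiv β).symm ⟨j, by omega⟩) = (digitEquiv β).symm ⟨j + 1, hj⟩ := by
      simp only [nextDigit, Equiv.apply_symm_apply]
      congr 1
      exact Fin.ext (Fin.val_add_one_of_lt (Fin.lt_def.2 (by simp; omega)))
    simp [advance, h1, h2, advance_false]

theorem advance_reaches_carry (a : Option β) (v : List (Option β)) :
    Relation.ReflTransGen (fun u u' => u' = advance true u)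
      (a :: v) ((digitEquiv β).symm 0 :: advance true v) := by
  have h := advance_reaches_digit v (digitEquiv β a) (Fintype.card β)
    (Nat.lt_succ_iff.1 (digitEquiv β a).2) (by omega)
  have ha : (digitEquiv β).symm ⟨(digitEquiv β a : ℕ), by omega⟩ = a := by simp
  rw [ha] at h
  refine h.tail ?_
  have h1 : carries ((digitEquiv β).symm ⟨Fintype.card β, by omega⟩) = true := by
    simp [carries, Fin.ext_iff]
  have h2 : nextDigit ((digitEquiv β).symm ⟨Fintype.card β, by omega⟩) =
      (digitEquiv β).symm 0 := by
    simp only [nextDigit, Equiv.apply_symm_apply]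
    congr 1
    exact Fin.last_add_one _
  simp [advance, h1, h2]

theorem advance_reaches (u t : List (Option β)) (h : u.length = t.length) :
    Relation.ReflTransGen (fun u u' => u' = advance true u) u t := by
  induction t generalizing u with
  | nil =>
    obtain rfl : u = [] := List.length_eq_zero_iff.1 h
    exact .refl
  | cons b t ih =>
    cases u with
    | nil => simp at h
    | cons a u =>
      -- One turn of the first digit advances the remaining ones by one.
      have h1 : ∀ u', Relation.ReflTransGen (fun u u' => u' = advance true u) u' t →
          Relation.ReflTransGen (fun u u' => u' = advance true u)
            ((digitEquiv β).symm 0 :: u') ((digitEquiv β).symm 0 :: t) := by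
        intro u' hu'
        induction hu' using Relation.ReflTransGen.head_induction_on with
        | refl => exact .refl
        | head hac _ ih =>
          subst hac
          exact (advance_reaches_carry _ _).trans ih
      have h2 := advance_reaches_digit t 0 (digitEquiv β b) (Nat.zero_le _) (by omega)
      have hb : (digitEquiv β).symm ⟨(digitEquiv β b : ℕ), by omega⟩ = b := by simp
      rw [hb] at h2
      have h3 := ih (advance true u) (by simpa [length_advance] using h)
      exact ((advance_reaches_carry a u).trans (h1 _ h3)).trans h2

/-- A growing odometer that is advanced infinitely often shows every word infinitely often: it is
enough to look at an initial segment of fixed length. -/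
theorem exists_decode_odometer_eq (v : ℕ → List (Option β)) (b : ℕ → Bool) (k : ℕ → ℕ)
    (hv : ∀ n, v (n + 1) = advance (b n) (v n ++ List.replicate (k n) none))
    (hb : ∃ᶠ n in Filter.atTop, b n = true) (u : List β)
    (hu : ∀ᶠ n in Filter.atTop, u.length + 1 ≤ (v n).length) (n₀ : ℕ) :
    ∃ n ≥ n₀, decode (v n) = u := by
  obtain ⟨n₁, hn₁⟩ := Filter.eventually_atTop.1 hu
  have htake : ∀ n ≥ n₁, (v (n + 1)).take (u.length + 1) =
      advance (b n) ((v n).take (u.length + 1)) := by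
    intro n hn
    rw [hv, take_advance, List.take_append_of_le_length (hn₁ n hn)]
  have hvisit : ∀ x t, Relation.ReflTransGen (fun u u' => u' = advance true u) x t →
      ∀ n ≥ n₁, (v n).take (u.length + 1) = x → ∃ m ≥ n, (v m).take (u.length + 1) = t := by
    intro x t hxt
    induction hxt using Relation.ReflTransGen.head_induction_on with
    | refl => exact fun n _ h => ⟨n, le_rfl, h⟩
    | @head a c hac _ ih =>
      subst hac
      intro n hn h
      have hex : ∃ m, n ≤ m ∧ b m = true := by
        obtain ⟨m, hm, hm'⟩ := Filter.frequently_atTop.1 hb n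
        exact ⟨m, hm, hm'⟩
      classical
      obtain ⟨hm, hm'⟩ := Nat.find_spec hex
      have hstay : ∀ j, n ≤ j → j ≤ Nat.find hex → (v j).take (u.length + 1) = a := by
        intro j hj
        induction j, hj using Nat.le_induction with
        | base => exact fun _ => h
        | succ j hj ih' =>
          intro hj'
          have hbj : b j = false := by
            by_contra hbj
            exact Nat.find_min hex hj' ⟨hj, by simpa using hbj⟩
          rw [htake j (by omega), hbj, advance_false, ih' (by omega)]
      have hnext : (v (Nat.find hex + 1)).take (u.length + 1) = advance true a := by
        rw [htake _ (by omega), hm', hstay _ hm le_rfl]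
      obtain ⟨m, h1, h2⟩ := ih _ (by omega) hnext
      exact ⟨m, by omega, h2⟩
  obtain ⟨n, hn, h⟩ := hvisit _ (u.map some ++ [none]) (advance_reaches _ _ (by
    have := hn₁ (max n₀ n₁) (le_max_right _ _)
    simp
    omega)) (max n₀ n₁) (le_max_right _ _) rfl
  refine ⟨n, le_trans (le_max_left _ _) hn, ?_⟩
  rw [← List.take_append_drop (u.length + 1) (v n), h, List.append_assoc]
  exact decode_map_some_append_cons_none _ _

end Odometer

/-! ### The learning procedure -/

/-- A memory cell: one digit each of the current hypothesis, of the challenger and of the fallback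
conjecture. -/
abbrev Cell (β : Type) : Type := Option β × Option β × Option β

/-- The data of the learner between two cycles. The words seen so far are divided into `done` and
`todo`; while `checking` is set, they are moved one by one from `todo` to `done` and compared with
hypothesis and challenger, otherwise they are moved back. -/
structure Stage (α β : Type) where
  /-- Is the learner in the checking mode? -/
  checking : Bool
  /-- All words checked in this pass belong to the language of the hypothesis. -/
  hypOk : Bool
  /-- All words checked in this pass belong to the language of the challenger. -/
  candOk : Bool
  cells : List (Cell β)
  done : List (List α)
  todo : List (List α)

/-- Advance the digits of hypothesis and challenger, with respective incoming carries. -/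
noncomputable def advanceCells {β : Type} [Fintype β] :
    Bool → Bool → List (Cell β) → List (Cell β)
  | _, _, [] => []
  | b, b', t :: l =>
    ((if b then nextDigit t.1 else t.1), (if b' then nextDigit t.2.1 else t.2.1), t.2.2) ::
      advanceCells (b && carries t.1) (b' && carries t.2.1) l

/-- Append blank cells up to the length `n`. -/
def padCells {β : Type} (n : ℕ) (l : List (Cell β)) : List (Cell β) :=
  l ++ List.replicate (n - l.length) (none, none, none)

namespace Stage

variable {α β : Type}

/-- The current hypothesis. -/
def hyp (S : Stage α β) : List β := decode (S.cells.map fun t => t.1)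

/-- The current challenger of the hypothesis. -/
def cand (S : Stage α β) : List β := decode (S.cells.map fun t => t.2.1)

/-- A pass through the data has been finished. -/
def passEnds (S : Stage α β) : Bool := S.checking && S.todo.isEmpty

open Classical in
/-- The challenger denotes a properly smaller language than the hypothesis. -/
noncomputable def beats (J : Language (Option β × Option α)) (S : Stage α β) : Bool :=
  decide (fiber J S.cand ⊂ fiber J S.hyp)

/-- The hypothesis is given up at the end of a pass if it is inconsistent with the data, or if the
challenger is consistent with them and denotes a properly smaller language. -/
noncomputable def refuted (J : Language (Option β × Option α)) (S : Stage α β) : Bool :=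
  S.passEnds && (!S.hypOk || S.candOk && S.beats J)

variable [Fintype β]

/-- The cells after a cycle with the datum `x`. -/
noncomputable def nextCells (J : Language (Option β × Option α)) (c : ℕ) (x : List α)
    (S : Stage α β) : List (Cell β) :=
  advanceCells (S.refuted J) S.passEnds (padCells (x.length + c) S.cells)

open Classical in
/-- The stage after a cycle with the datum `x`. The datum goes to the side to which the words are
moved, so that each pass comes to an end. -/
noncomputable def next (J : Language (Option β × Option α)) (c : ℕ) (x : List α)
    (S : Stage α β) : Stage α β :=
  match S.checking, S.done, S.todo with
  | false, [], t => ⟨true, S.hypOk, S.candOk, S.nextCells J c x, [], x :: t⟩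
  | false, a :: d, t => ⟨false, S.hypOk, S.candOk, S.nextCells J c x, d, a :: x :: t⟩
  | true, d, [] => ⟨false, true, true, S.nextCells J c x, x :: d, []⟩
  | true, d, y :: t => ⟨true, S.hypOk && decide (y ∈ fiber J S.hyp),
      S.candOk && decide (y ∈ fiber J S.cand), S.nextCells J c x, y :: x :: d, t⟩

/-- The first stage; the fallback conjecture is `e₀`. -/
def initial (c : ℕ) (e₀ : List β) : Stage α β where
  checking := false
  hypOk := true
  candOk := true
  cells := padCells c (e₀.map fun b => (none, none, some b))
  done := []
  todo := []

/-- The stage before cycle `n` on the data `w`. -/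
noncomputable def run (J : Language (Option β × Option α)) (c : ℕ) (e₀ : List β)
    (w : ℕ → List α) : ℕ → Stage α β
  | 0 => initial c e₀
  | n + 1 => (run J c e₀ w n).next J c (w n)

end Stage

section StageLemmas

theorem length_padCells {β : Type} (n : ℕ) (l : List (Cell β)) : (padCells n l).length = max l.length n := by
  simp [padCells]
  omega

theorem Stage.refuted_eq_false_of_passEnds {α β : Type} (J : Language (Option β × Option α))
    (S : Stage α β) (h : S.passEnds = false) : S.refuted J = false := by
  simp [refuted, h]

variable {α β : Type} [Fintype β]

theorem map_fst_advanceCells (b b' : Bool) (l : List (Cell β)) :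
    (advanceCells b b' l).map (fun t => t.1) = advance b (l.map fun t => t.1) := by
  induction l generalizing b b' with
  | nil => rfl
  | cons t l ih => simp [advanceCells, advance, ih]

theorem map_snd_fst_advanceCells (b b' : Bool) (l : List (Cell β)) :
    (advanceCells b b' l).map (fun t => t.2.1) = advance b' (l.map fun t => t.2.1) := by
  induction l generalizing b b' with
  | nil => rfl
  | cons t l ih => simp [advanceCells, advance, ih]

theorem map_snd_snd_advanceCells (b b' : Bool) (l : List (Cell β)) :
    (advanceCells b b' l).map (fun t => t.2.2) = l.map fun t => t.2.2 := by
  induction l generalizing b b' with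
  | nil => rfl
  | cons t l ih => simp [advanceCells, ih]

theorem length_advanceCells (b b' : Bool) (l : List (Cell β)) :
    (advanceCells b b' l).length = l.length := by
  induction l generalizing b b' with
  | nil => rfl
  | cons t l ih => simp [advanceCells, ih]

namespace Stage

variable (J : Language (Option β × Option α)) (c : ℕ) (x : List α) (S : Stage α β)

theorem cells_next : (S.next J c x).cells = S.nextCells J c x := by
  obtain ⟨ch, h, d, cells, done, todo⟩ := S
  cases ch <;> cases done <;> cases todo <;> rfl

theorem length_nextCells :
    (S.nextCells J c x).length = max S.cells.length (x.length + c) := by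
  rw [nextCells, length_advanceCells, length_padCells]

theorem map_fst_nextCells :
    (S.nextCells J c x).map (fun t => t.1) = advance (S.refuted J) (S.cells.map (fun t => t.1) ++
      List.replicate (x.length + c - S.cells.length) none) := by
  rw [nextCells, map_fst_advanceCells, padCells, List.map_append, List.map_replicate]

theorem map_snd_fst_nextCells :
    (S.nextCells J c x).map (fun t => t.2.1) = advance S.passEnds (S.cells.map (fun t => t.2.1) ++
      List.replicate (x.length + c - S.cells.length) none) := by
  rw [nextCells, map_snd_fst_advanceCells, padCells, List.map_append, List.map_replicate]

theorem map_snd_snd_nextCells :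
    (S.nextCells J c x).map (fun t => t.2.2) = S.cells.map (fun t => t.2.2) ++
      List.replicate (x.length + c - S.cells.length) none := by
  rw [nextCells, map_snd_snd_advanceCells, padCells, List.map_append, List.map_replicate]

theorem hyp_next (h : S.refuted J = false) : (S.next J c x).hyp = S.hyp := by
  rw [hyp, cells_next, map_fst_nextCells, h, advance_false, decode_append_replicate_none, hyp]

theorem cand_next (h : S.passEnds = false) : (S.next J c x).cand = S.cand := by
  rw [cand, cells_next, map_snd_fst_nextCells, h, advance_false, decode_append_replicate_none,
    cand]

theorem mem_next (y : List α) :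
    (y ∈ (S.next J c x).done ∨ y ∈ (S.next J c x).todo) ↔
      y = x ∨ y ∈ S.done ∨ y ∈ S.todo := by
  obtain ⟨ch, h, d, cells, done, todo⟩ := S
  cases ch <;> cases done <;> cases todo <;> simp [next] <;> tauto

variable (e₀ : List β) (w : ℕ → List α)

theorem mem_run (n : ℕ) (y : List α) :
    (y ∈ (run J c e₀ w n).done ∨ y ∈ (run J c e₀ w n).todo) ↔ ∃ i < n, w i = y := by
  induction n with
  | zero => simp [run, initial]
  | succ n ih =>
    rw [run, mem_next, ih]
    constructor
    · rintro (rfl | ⟨i, hi, rfl⟩)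
      · exact ⟨n, by omega, rfl⟩
      · exact ⟨i, by omega, rfl⟩
    · rintro ⟨i, hi, rfl⟩
      rcases Nat.lt_succ_iff_lt_or_eq.1 hi with hi | rfl
      · exact .inr ⟨i, hi, rfl⟩
      · exact .inl rfl

theorem length_cells_run (hc : e₀.length ≤ c) (n : ℕ) :
    (run J c e₀ w n).cells.length = longestDatum w n + c := by
  induction n with
  | zero => simp [run, initial, length_padCells, longestDatum, hc]
  | succ n ih =>
    rw [run, cells_next, length_nextCells, ih]
    simp only [longestDatum, Finset.range_add_one, Finset.sup_insert]
    change max _ _ = max _ _ + c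
    omega

theorem map_snd_snd_cells_run (n : ℕ) :
    ∃ k, (run J c e₀ w n).cells.map (fun t => t.2.2) = e₀.map some ++ List.replicate k none := by
  induction n with
  | zero => exact ⟨c - e₀.length, by simp [run, initial, padCells, Function.comp_def]⟩
  | succ n ih =>
    obtain ⟨k, hk⟩ := ih
    refine ⟨k + ((w n).length + c - (run J c e₀ w n).cells.length), ?_⟩
    rw [run, cells_next, map_snd_snd_nextCells, hk, List.append_assoc,
      List.replicate_append_replicate]

/-- Passes do not last forever. -/
theorem frequently_passEnds : ∃ᶠ n in Filter.atTop, (run J c e₀ w n).passEnds = true := by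
  have h1 : ∀ (k n : ℕ), (run J c e₀ w n).checking = true → (run J c e₀ w n).todo.length = k →
      ∃ m ≥ n, (run J c e₀ w m).passEnds = true := by
    intro k
    induction k with
    | zero =>
      intro n h h'
      exact ⟨n, le_rfl, by simp [passEnds, h, List.length_eq_zero_iff.1 h']⟩
    | succ k ih =>
      intro n h h'
      obtain ⟨m, hm, hm'⟩ := ih (n + 1)
        (by
          rw [run]
          generalize run J c e₀ w n = S at *
          obtain ⟨ch, _, _, cells, done, todo⟩ := S
          cases ch <;> cases done <;> cases todo <;> simp_all [next])
        (by
          rw [run]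
          generalize run J c e₀ w n = S at *
          obtain ⟨ch, _, _, cells, done, todo⟩ := S
          cases ch <;> cases done <;> cases todo <;> simp_all [next])
      exact ⟨m, by omega, hm'⟩
  have h2 : ∀ (k n : ℕ), (run J c e₀ w n).checking = false → (run J c e₀ w n).done.length = k →
      ∃ m ≥ n, (run J c e₀ w m).passEnds = true := by
    intro k
    induction k with
    | zero =>
      intro n h h'
      obtain ⟨m, hm, hm'⟩ := h1 _ (n + 1)
        (by
          rw [run]
          generalize run J c e₀ w n = S at *
          obtain ⟨ch, _, _, cells, done, todo⟩ := S
          cases ch <;> cases done <;> cases todo <;> simp_all [next]) rfl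
      exact ⟨m, by omega, hm'⟩
    | succ k ih =>
      intro n h h'
      obtain ⟨m, hm, hm'⟩ := ih (n + 1)
        (by
          rw [run]
          generalize run J c e₀ w n = S at *
          obtain ⟨ch, _, _, cells, done, todo⟩ := S
          cases ch <;> cases done <;> cases todo <;> simp_all [next])
        (by
          rw [run]
          generalize run J c e₀ w n = S at *
          obtain ⟨ch, _, _, cells, done, todo⟩ := S
          cases ch <;> cases done <;> cases todo <;> simp_all [next])
      exact ⟨m, by omega, hm'⟩
  refine Filter.frequently_atTop.2 fun n => ?_
  cases h : (run J c e₀ w n).checking with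
  | true => exact h1 _ n h rfl
  | false => exact h2 _ n h rfl

/-- The flags `hypOk` and `candOk` are cleared for a reason only. -/
theorem exists_notMem_of_ok_eq_false (n : ℕ) :
    ((run J c e₀ w n).hypOk = false → ∃ i, w i ∉ fiber J (run J c e₀ w n).hyp) ∧
      ((run J c e₀ w n).candOk = false → ∃ i, w i ∉ fiber J (run J c e₀ w n).cand) := by
  classical
  induction n with
  | zero => simp [run, initial]
  | succ n ih =>
    have hmem : ∀ y ∈ (run J c e₀ w n).todo, ∃ i, w i = y := fun y hy =>
      ((mem_run J c e₀ w n y).1 (.inr hy)).imp fun _ h => h.2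
    rw [run]
    generalize run J c e₀ w n = S at *
    have hS : S.passEnds = false →
        (S.next J c (w n)).hyp = S.hyp ∧ (S.next J c (w n)).cand = S.cand := fun h =>
      ⟨hyp_next J c _ S (S.refuted_eq_false_of_passEnds J h), cand_next J c _ S h⟩
    obtain ⟨ch, h, d, cells, done, todo⟩ := S
    cases ch <;> cases todo
    · rw [(hS rfl).1, (hS rfl).2]
      cases done <;> exact ih
    · rw [(hS rfl).1, (hS rfl).2]
      cases done <;> exact ih
    · simp [next]
    · rename_i y t
      rw [(hS rfl).1, (hS rfl).2]
      obtain ⟨i, hi⟩ := hmem y (by simp)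
      constructor
      · intro h'
        rcases Bool.and_eq_false_iff.1 h' with h' | h'
        · exact ih.1 h'
        · exact ⟨i, by rw [hi]; exact of_decide_eq_false h'⟩
      · intro h'
        rcases Bool.and_eq_false_iff.1 h' with h' | h'
        · exact ih.2 h'
        · exact ⟨i, by rw [hi]; exact of_decide_eq_false h'⟩

/-- From some time on, each datum is taken into account in every pass. -/
theorem eventually_mem_of_passEnds (i : ℕ) :
    ∀ᶠ n in Filter.atTop, (run J c e₀ w n).passEnds = true →
      ((run J c e₀ w n).hypOk = true → w i ∈ fiber J (run J c e₀ w n).hyp) ∧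
        ((run J c e₀ w n).candOk = true → w i ∈ fiber J (run J c e₀ w n).cand) := by
  classical
  obtain ⟨n₁, hn₁, hend⟩ := Filter.frequently_atTop.1 (frequently_passEnds J c e₀ w) (i + 1)
  have key : ∀ n ≥ n₁ + 1, (run J c e₀ w n).checking = true → w i ∉ (run J c e₀ w n).todo →
      ((run J c e₀ w n).hypOk = true → w i ∈ fiber J (run J c e₀ w n).hyp) ∧
        ((run J c e₀ w n).candOk = true → w i ∈ fiber J (run J c e₀ w n).cand) := by
    intro n hn
    induction n, hn using Nat.le_induction with
    | base =>
      rw [run]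
      generalize run J c e₀ w n₁ = S at *
      obtain ⟨ch, h, d, cells, done, todo⟩ := S
      cases ch <;> cases todo <;> simp [passEnds] at hend
      simp [next]
    | succ n hn ih =>
      have hmem := (mem_run J c e₀ w n (w i)).2 ⟨i, by omega, rfl⟩
      rw [run]
      generalize run J c e₀ w n = S at *
      have hS : S.passEnds = false →
          (S.next J c (w n)).hyp = S.hyp ∧ (S.next J c (w n)).cand = S.cand := fun h =>
        ⟨hyp_next J c _ S (S.refuted_eq_false_of_passEnds J h), cand_next J c _ S h⟩
      obtain ⟨ch, h, d, cells, done, todo⟩ := S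
      cases ch
      · cases done with
        | nil =>
          intro _ h'
          have h1 : w i ∉ w n :: todo := h'
          have h2 : w i ∈ todo := by simpa using hmem
          exact absurd (List.mem_cons_of_mem _ h2) h1
        | cons a done => exact fun h => by simp [next] at h
      · cases todo with
        | nil => exact fun h => by simp [next] at h
        | cons y t =>
          intro _ h'
          have h1 : w i ∉ t := h'
          rw [(hS rfl).1, (hS rfl).2]
          by_cases hy : w i = y
          · subst hy
            exact ⟨fun h => of_decide_eq_true (Bool.and_eq_true_iff.1 h).2,
              fun h => of_decide_eq_true (Bool.and_eq_true_iff.1 h).2⟩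
          · have h2 := ih rfl (by simpa [hy] using h1)
            exact ⟨fun h => h2.1 (Bool.and_eq_true_iff.1 h).1,
              fun h => h2.2 (Bool.and_eq_true_iff.1 h).1⟩
  refine Filter.eventually_atTop.2 ⟨n₁ + 1, fun n hn hp => ?_⟩
  have hp' := Bool.and_eq_true_iff.1 hp
  refine key n hn hp'.1 ?_
  rw [List.isEmpty_iff.1 hp'.2]
  exact List.not_mem_nil

/-- The hypotheses converge to an index of the language `fiber J e`, provided that this has a
tell-tale set `s`, and that the memory eventually has space for `e`. -/
theorem hyp_converges (e : List β) (s : List (List α))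
    (htext : ∀ y, y ∈ fiber J e ↔ ∃ n, w n = y) (hs : ∀ y ∈ s, y ∈ fiber J e)
    (htell : ∀ d, (∀ y ∈ s, y ∈ fiber J d) → ¬ fiber J d ⊂ fiber J e)
    (hspace : ∀ᶠ n in Filter.atTop, e.length + 1 ≤ (run J c e₀ w n).cells.length) :
    ∃ h n₁, fiber J h = fiber J e ∧ ∀ n ≥ n₁, (run J c e₀ w n).hyp = h := by
  classical
  have hw : ∀ i, w i ∈ fiber J e := fun i => (htext _).2 ⟨i, rfl⟩
  have hsound := exists_notMem_of_ok_eq_false J c e₀ w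
  by_cases hfreq : ∃ᶠ n in Filter.atTop, (run J c e₀ w n).refuted J = true
  · -- After all of `s` has been seen, the hypothesis `e` is reached, and it is kept.
    exfalso
    have hall : ∀ᶠ n in Filter.atTop, ∀ y ∈ s, (run J c e₀ w n).passEnds = true →
        (run J c e₀ w n).candOk = true → y ∈ fiber J (run J c e₀ w n).cand := by
      refine (Filter.eventually_all_finite s.finite_toSet).2 fun y hy => ?_
      obtain ⟨i, rfl⟩ := (htext y).1 (hs y hy)
      exact (eventually_mem_of_passEnds J c e₀ w i).mono fun n h h' => (h h').2
    obtain ⟨n₂, hn₂⟩ := Filter.eventually_atTop.1 hall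
    obtain ⟨n, hn, hne⟩ := exists_decode_odometer_eq
      (fun n => (run J c e₀ w n).cells.map fun t => t.1) (fun n => (run J c e₀ w n).refuted J)
      (fun n => (w n).length + c - (run J c e₀ w n).cells.length)
      (fun n => by simp only [run, cells_next, map_fst_nextCells]) hfreq e (by simpa using hspace)
      n₂
    have hno : ∀ m ≥ n, (run J c e₀ w m).hyp = e → (run J c e₀ w m).refuted J = false := by
      intro m hm he
      by_contra hr
      have hr' : (run J c e₀ w m).refuted J = true := by simpa using hr
      simp only [refuted, Bool.and_eq_true_iff, Bool.or_eq_true_iff, Bool.not_eq_true'] at hr'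
      obtain ⟨hp, hr' | ⟨hd, hb⟩⟩ := hr'
      · obtain ⟨i, hi⟩ := (hsound m).1 hr'
        rw [he] at hi
        exact hi (hw i)
      · have hb' := of_decide_eq_true hb
        rw [he] at hb'
        exact htell _ (fun y hy => hn₂ m (by omega) y hy hp hd) hb'
    have hstay : ∀ m ≥ n, (run J c e₀ w m).hyp = e := by
      intro m hm
      induction m, hm using Nat.le_induction with
      | base => exact hne
      | succ m hm ih => rw [run, hyp_next J c _ _ (hno m hm ih), ih]
    obtain ⟨m, hm, hm'⟩ := Filter.frequently_atTop.1 hfreq n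
    rw [hno m hm (hstay m hm)] at hm'
    exact Bool.false_ne_true hm'
  · obtain ⟨n₁, hn₁⟩ := Filter.eventually_atTop.1 (Filter.not_frequently.1 hfreq)
    have hstay : ∀ m ≥ n₁, (run J c e₀ w m).hyp = (run J c e₀ w n₁).hyp := by
      intro m hm
      induction m, hm using Nat.le_induction with
      | base => rfl
      | succ m hm ih => rw [run, hyp_next J c _ _ (by simpa using hn₁ m hm), ih]
    refine ⟨(run J c e₀ w n₁).hyp, n₁, ?_, hstay⟩
    have hpass : ∀ m ≥ n₁, (run J c e₀ w m).passEnds = true →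
        (run J c e₀ w m).hypOk = true ∧
          ((run J c e₀ w m).candOk = true → ¬ fiber J (run J c e₀ w m).cand ⊂
            fiber J (run J c e₀ w n₁).hyp) := by
      intro m hm hp
      have h := hn₁ m hm
      simp only [refuted, hp, beats] at h
      rw [← hstay m hm]
      simpa using h
    have hsub : fiber J e ⊆ fiber J (run J c e₀ w n₁).hyp := by
      intro y hy
      obtain ⟨i, rfl⟩ := (htext y).1 hy
      obtain ⟨n₂, hn₂⟩ := Filter.eventually_atTop.1 (eventually_mem_of_passEnds J c e₀ w i)
      obtain ⟨m, hm, hp⟩ := Filter.frequently_atTop.1 (frequently_passEnds J c e₀ w) (max n₁ n₂)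
      have hm₁ : n₁ ≤ m := le_trans (le_max_left _ _) hm
      have h := (hn₂ m (le_trans (le_max_right _ _) hm) hp).1 (hpass m hm₁ hp).1
      rwa [hstay m hm₁] at h
    by_contra hne
    -- Otherwise the challenger `e` would refute the final hypothesis.
    obtain ⟨n, hn, hcand⟩ := exists_decode_odometer_eq
      (fun n => (run J c e₀ w n).cells.map fun t => t.2.1) (fun n => (run J c e₀ w n).passEnds)
      (fun n => (w n).length + c - (run J c e₀ w n).cells.length)
      (fun n => by simp only [run, cells_next, map_snd_fst_nextCells])
      (frequently_passEnds J c e₀ w) e (by simpa using hspace) n₁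
    have hex : ∃ m, n ≤ m ∧ (run J c e₀ w m).passEnds = true := by
      obtain ⟨m, hm, hm'⟩ := Filter.frequently_atTop.1 (frequently_passEnds J c e₀ w) n
      exact ⟨m, hm, hm'⟩
    obtain ⟨hm, hp⟩ := Nat.find_spec hex
    have hkeep : ∀ j, n ≤ j → j ≤ Nat.find hex → (run J c e₀ w j).cand = e := by
      intro j hj
      induction j, hj using Nat.le_induction with
      | base => exact fun _ => hcand
      | succ j hj ih =>
        intro hj'
        have hpj : (run J c e₀ w j).passEnds = false := by
          by_contra hpj
          exact Nat.find_min hex hj' ⟨hj, by simpa using hpj⟩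
        rw [run, cand_next J c _ _ hpj, ih (by omega)]
    have hc := hkeep _ hm le_rfl
    refine (hpass _ (by omega) hp).2 ?_ ?_
    · by_contra hd
      obtain ⟨i, hi⟩ := (hsound _).2 (by simpa using hd)
      rw [hc] at hi
      exact hi (hw i)
    · rw [hc]
      exact hsub.ssubset_of_ne fun h => hne h.symm

end Stage

end StageLemmas

/-! ### The Turing machine -/

/-- The flags in the memory: the fields of the stage, and whether the challenger denotes a properly
smaller language than the hypothesis. -/
structure Flags where
  checking : Bool
  hypOk : Bool
  candOk : Bool
  beats : Bool

/-- A finite automaton that reads the digits of hypothesis and challenger together with the letters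
of a word; its state answers the questions that the learner asks about them. -/
structure Checker (α β : Type) where
  State : Type
  [finite : Finite State]
  start : State
  step : State → Option β × Option β × Option α → State
  /-- Is the hypothesis an index? -/
  isIndex : State → Bool
  /-- Does the challenger denote a properly smaller language than the hypothesis? -/
  beats : State → Bool
  /-- Does the word belong to the language of the hypothesis? -/
  memHyp : State → Bool
  /-- Does the word belong to the language of the challenger? -/
  memCand : State → Bool

attribute [instance] Checker.finite

/-- Operations on a work tape that is used as a stack. -/
inductive StackOp (γ : Type)
  | keep
  | push (a : γ)
  | pop

/-- The effect of an operation on the content of the stack, which is listed from the top. -/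
def StackOp.apply {γ : Type} : StackOp γ → List γ → List γ
  | keep, l => l
  | push a, l => a :: l
  | pop, l => l.tail

/-- The direction in which a word is being moved between the two stacks. -/
inductive Direction
  | idle
  | toTodo
  | toDone

/-- One step of moving a word to the other stack, given the topmost symbols of the stack of the
words that are done, and of that of the words to do. The symbol `none` marks the bottom of a word;
the marker at the other side is to be written beforehand. -/
def moveLetter {α : Type} : Direction → Option (Option α) → Option (Option α) →
    Direction × StackOp (Option α) × StackOp (Option α)
  | .idle, _, _ => (.idle, .keep, .keep)
  | .toTodo, some (some a), _ => (.toTodo, .pop, .push (some a))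
  | .toTodo, _, _ => (.idle, .pop, .keep)
  | .toDone, _, some (some a) => (.toDone, .push (some a), .pop)
  | .toDone, _, _ => (.idle, .keep, .pop)

/-- The letter that is compared with hypothesis and challenger while a word is being moved. -/
def comparedLetter {α : Type} : Direction → Option (Option α) → Option α
  | .toDone, some (some a) => some a
  | _, _ => none

/-- The control state in the third phase of a cycle. -/
structure CheckState {α β : Type} (C : Checker α β) where
  flags : Flags
  dir : Direction
  /-- Is a word being compared with hypothesis and challenger? -/
  comparing : Bool
  /-- The carry of the hypothesis. -/
  hypCarry : Bool
  /-- The carry of the challenger. -/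
  candCarry : Bool
  /-- The hypothesis has not ended yet. -/
  live : Bool
  state : C.State

/-- The control states. In a cycle, the base head goes right, left, right and left once more: it
stores the datum and extends the memory to `c` cells more than the datum has letters (`format`),
moves the datum to the other stack if required (`shift`), treats one of the stored words and
advances the odometers (`check`), and writes conjecture and flags (`emit`). -/
inductive Control {α β : Type} (C : Checker α β) (c : ℕ)
  | format (f : Flags) (j : Fin (c + 1))
  | shift (f : Flags) (d : Direction)
  | check (s : CheckState C)
  | emit (f : Flags) (good : Bool)
  | done

instance : Finite Flags :=
  .of_injective (fun f => (f.checking, f.hypOk, f.candOk, f.beats)) fun f g h => by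
    cases f
    cases g
    simpa using h

instance : Finite Direction :=
  .of_surjective (fun i : Fin 3 => match i with
    | 0 => Direction.idle
    | 1 => Direction.toTodo
    | 2 => Direction.toDone) fun d => by
    cases d
    exacts [⟨0, rfl⟩, ⟨1, rfl⟩, ⟨2, rfl⟩]

instance {γ : Type} [Finite γ] : Finite (StackOp γ) :=
  .of_surjective (fun i : Option (Option γ) => match i with
    | none => StackOp.keep
    | some none => StackOp.pop
    | some (some a) => StackOp.push a) fun d => by
    cases d
    exacts [⟨none, rfl⟩, ⟨some (some _), rfl⟩, ⟨some none, rfl⟩]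

instance {α β : Type} (C : Checker α β) : Finite (CheckState C) :=
  .of_injective
    (fun s => (s.flags, s.dir, s.comparing, s.hypCarry, s.candCarry, s.live, s.state))
    fun f g h => by
      cases f
      cases g
      simpa using h

instance {α β : Type} (C : Checker α β) (c : ℕ) : Finite (Control C c) :=
  .of_surjective (fun i : (Flags × Fin (c + 1)) ⊕ (Flags × Direction) ⊕ CheckState C ⊕
      (Flags × Bool) ⊕ Unit => match i with
    | .inl p => Control.format p.1 p.2
    | .inr (.inl p) => Control.shift p.1 p.2
    | .inr (.inr (.inl s)) => Control.check s
    | .inr (.inr (.inr (.inl p))) => Control.emit p.1 p.2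
    | .inr (.inr (.inr (.inr _))) => Control.done) fun d => by
    cases d
    exacts [⟨.inl (_, _), rfl⟩, ⟨.inr (.inl (_, _)), rfl⟩, ⟨.inr (.inr (.inl _)), rfl⟩,
      ⟨.inr (.inr (.inr (.inl (_, _)))), rfl⟩, ⟨.inr (.inr (.inr (.inr ()))), rfl⟩]

/-- The tape symbols; the further symbols are those of the stacks. -/
abbrev LSymbol (α β : Type) : Type := TapeSymbol α β (Cell β × Flags) (Option α)

/-- Flags without significance. -/
def someFlags : Flags := ⟨false, false, false, false⟩

section Stack

variable {α β : Type}

/-- The topmost symbol of a stack, given the scanned symbol. -/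
def topOf : Option (LSymbol α β) → Option (Option α)
  | some (.work a) => some a
  | _ => none

/-- The first half of a stack operation. -/
def StackOp.headMove {γ : Type} : StackOp γ → Move
  | keep => .stay
  | push _ => .right
  | pop => .left

/-- The symbol that is written in the second half of a stack operation. -/
def StackOp.symbol : StackOp (Option α) → Option (LSymbol α β) → LSymbol α β
  | push a, _ => .work a
  | _, s => s.getD .blank

/-- The work tape `t` represents the stack `l`; symbols beyond the head do not matter. -/
def IsStack (t : WorkTape (LSymbol α β)) (l : List (Option α)) : Prop :=
  t.head = l.length ∧ ∀ p a r, l = p ++ a :: r → t.cells r.length = .work a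

theorem WorkTape.write_read (t : WorkTape (LSymbol α β)) : t.write (t.read.getD .blank) = t := by
  obtain ⟨cells, head⟩ := t
  cases head <;> simp [write, read]

theorem IsStack.topOf_read {t : WorkTape (LSymbol α β)} {l : List (Option α)} (h : IsStack t l) :
    topOf t.read = l.head? := by
  obtain ⟨cells, head⟩ := t
  obtain ⟨h1, h2⟩ := h
  cases l with
  | nil =>
    obtain rfl : head = 0 := h1
    rfl
  | cons a l =>
    obtain rfl : head = l.length + 1 := h1
    have h3 : cells l.length = .work a := h2 [] a l rfl
    simp [WorkTape.read, h3, topOf]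

theorem IsStack.apply {t : WorkTape (LSymbol α β)} {l : List (Option α)} (h : IsStack t l)
    (o : StackOp (Option α)) :
    IsStack ((((t.write (t.read.getD .blank)).move o.headMove).write
      (o.symbol ((t.write (t.read.getD .blank)).move o.headMove).read)).move .stay) (o.apply l) := by
  rw [WorkTape.write_read]
  cases o with
  | keep => simpa [StackOp.headMove, StackOp.symbol, WorkTape.move, WorkTape.write_read,
      StackOp.apply] using h
  | pop =>
    obtain ⟨h1, h2⟩ := h
    simp only [StackOp.headMove, StackOp.symbol, WorkTape.write_read]
    refine ⟨by simp [WorkTape.move, StackOp.apply, h1], fun p a r hl => ?_⟩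
    cases l with
    | nil => simp [StackOp.apply] at hl
    | cons b l =>
      obtain rfl : l = p ++ a :: r := hl
      exact h2 (b :: p) a r rfl
  | push b =>
    obtain ⟨h1, h2⟩ := h
    refine ⟨by simp [WorkTape.move, WorkTape.write, StackOp.headMove, StackOp.apply, h1],
      fun p a r hl => ?_⟩
    simp only [WorkTape.move, WorkTape.write, StackOp.headMove, StackOp.symbol, h1]
    cases p with
    | nil =>
      obtain ⟨rfl, rfl⟩ : b = a ∧ l = r := by simpa [StackOp.apply] using hl
      simp
    | cons b' p =>
      obtain ⟨rfl, rfl⟩ : b = b' ∧ l = p ++ a :: r := by simpa [StackOp.apply] using hl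
      rw [Function.update_of_ne (by simp; omega)]
      exact h2 p a r rfl

end Stack

section Machine

variable {α β : Type} [Fintype β] (C : Checker α β) (c : ℕ)

/-- The result of a step of the first phase at a cell with an input symbol. The counter `j` holds
the number of cells that are required to the right of the current one. -/
def formatCell (f : Flags) (j : Fin (c + 1)) (x : Option α) (m : Option (Cell β × Flags)) :
    Control C c × LSymbol α β × Move × StackOp (Option α) × StackOp (Option α) :=
  (.format (m.elim f Prod.snd)
      (if x.isSome then Fin.last c else ⟨j - 1, by have := j.2; omega⟩),
    .output (none, some (m.elim (none, none, none) Prod.fst, someFlags)), .right,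
    x.elim .keep fun a => .push (some a), .keep)

/-- The beginning of the third phase. Depending on the mode and on the topmost symbols of the
stacks, either the mode changes or the next word is moved. -/
def beginCheck (f : Flags) (a b : Option (Option α)) :
    CheckState C × StackOp (Option α) × StackOp (Option α) :=
  match f.checking, a, b with
  | false, none, _ =>
    (⟨⟨true, f.hypOk, f.candOk, false⟩, .idle, false, false, false, true, C.start⟩, .keep, .keep)
  | false, some _, _ =>
    (⟨⟨false, f.hypOk, f.candOk, false⟩, .toTodo, false, false, false, true, C.start⟩,
      .keep, .push none)
  | true, _, none =>
    (⟨⟨false, true, true, false⟩, .idle, false, !f.hypOk || f.candOk && f.beats, true, true,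
      C.start⟩, .keep, .keep)
  | true, _, some _ =>
    (⟨⟨true, f.hypOk, f.candOk, false⟩, .toDone, true, false, false, true, C.start⟩,
      .push none, .keep)

/-- The new content of a memory cell in the third phase. -/
noncomputable def CheckState.cell {C : Checker α β} (s : CheckState C) (t : Cell β) : Cell β :=
  ((if s.hypCarry then nextDigit t.1 else t.1), (if s.candCarry then nextDigit t.2.1 else t.2.1),
    t.2.2)

/-- The control state after a cell in the third phase. -/
noncomputable def CheckState.next {C : Checker α β} (s : CheckState C) (t : Cell β)
    (a b : Option (Option α)) : CheckState C where
  flags := s.flags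
  dir := (moveLetter s.dir a b).1
  comparing := s.comparing
  hypCarry := s.hypCarry && carries t.1
  candCarry := s.candCarry && carries t.2.1
  live := s.live && (s.cell t).1.isSome
  state := C.step s.state ((s.cell t).1, (s.cell t).2.1, comparedLetter s.dir b)

/-- The flags for the new memory at the end of the third phase. -/
def CheckState.finalFlags {C : Checker α β} (s : CheckState C) : Flags :=
  ⟨s.flags.checking, s.flags.hypOk && (!s.comparing || C.memHyp s.state),
    s.flags.candOk && (!s.comparing || C.memCand s.state), C.beats s.state⟩

/-- The program, given the symbol on the base tape and the topmost symbols of the stacks. -/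
noncomputable def program : Control C c → Option (LSymbol α β) → Option (Option α) →
    Option (Option α) → Control C c × LSymbol α β × Move × StackOp (Option α) × StackOp (Option α)
  | .format f j, none, _, _ => (.format f j, .blank, .right, .push none, .keep)
  | .format f j, some (.input (x, m)), _, _ => formatCell C c f j x m
  | .format f j, some .blank, _, _ =>
    if j.1 = 0 then
      if f.checking then (.shift f .idle, .blank, .left, .keep, .keep)
      else (.shift f .toTodo, .blank, .left, .keep, .push none)
    else formatCell C c f j none none
  | .shift f _, none, a, b =>
    (.check (beginCheck C f a b).1, .blank, .right, (beginCheck C f a b).2.1,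
      (beginCheck C f a b).2.2)
  | .shift f d, some s, a, b =>
    (.shift f (moveLetter d a b).1, s, .left, (moveLetter d a b).2.1, (moveLetter d a b).2.2)
  | .check s, some (.output (_, some (t, _))), a, b =>
    (.check (s.next t a b),
      .output (if s.live then (s.cell t).1 else none, some (s.cell t, someFlags)), .right,
      (moveLetter s.dir a b).2.1, (moveLetter s.dir a b).2.2)
  | .check s, some .blank, _, _ =>
    (.emit s.finalFlags (C.isIndex s.state), .blank, .left, .keep, .keep)
  | .emit f g, some (.output (o, some (t, _))), _, _ =>
    (.emit f g, .output (if g then o else t.2.2, some (t, f)), .left, .keep, .keep)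
  | _, _, _, _ => (.done, .blank, .stay, .keep, .keep)

/-- The learner. Each step of the program takes two steps: the second one completes the
stack operations, as a new symbol is to be written to the right of the topmost one. -/
noncomputable def machine (e₀ : List β) [Finite α] : TapeLearner α β 2 where
  State := Control C c × Option (StackOp (Option α) × StackOp (Option α))
  Mem := Cell β × Flags
  Work := Option α
  start := (.format someFlags (Fin.last c), none)
  accept := (.done, none)
  initialMemory :=
    (padCells c (e₀.map fun b => (none, none, some b))).map fun t => (t, ⟨false, true, true, false⟩)
  transition := fun q s =>
    match q.2 with
    | none =>
      let r := program C c q.1 (s 0) (topOf (s 1)) (topOf (s 2))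
      ((r.1, some r.2.2.2), ![(r.2.1, r.2.2.1), ((s 1).getD .blank, r.2.2.2.1.headMove),
        ((s 2).getD .blank, r.2.2.2.2.headMove)])
    | some o =>
      ((q.1, none), ![((s 0).getD .blank, .stay), (o.1.symbol (s 1), .stay),
        (o.2.symbol (s 2), .stay)])

/-! ### Simulation of the program -/

/-- The configurations of the program: control, base tape, and the contents of the stacks. -/
structure PConfig where
  control : Control C c
  base : WorkTape (LSymbol α β)
  done : List (Option α)
  todo : List (Option α)

/-- One step of the program. -/
noncomputable def PConfig.next (x : PConfig C c) : PConfig C c :=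
  let r := program C c x.control x.base.read x.done.head? x.todo.head?
  ⟨r.1, (x.base.write r.2.1).move r.2.2.1, r.2.2.2.1.apply x.done, r.2.2.2.2.apply x.todo⟩

/-- `y` is reached from `x` in `k` steps of the program, which do not halt earlier, and before
which the base head is at most at position `H`. -/
inductive PConfig.Reaches (H : ℕ) : PConfig C c → ℕ → PConfig C c → Prop
  | refl (x) : Reaches H x 0 x
  | head {x k y} : x.control ≠ .done → x.base.head ≤ H → Reaches H (x.next) k y →
      Reaches H x (k + 1) y

variable {C c}

theorem PConfig.Reaches.trans {H : ℕ} {x y z : PConfig C c} {k l : ℕ} (h : Reaches C c H x k y)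
    (h' : Reaches C c H y l z) : Reaches C c H x (k + l) z := by
  induction h with
  | refl => simpa using h'
  | head h1 h2 _ ih =>
    rw [Nat.add_right_comm]
    exact .head h1 h2 (ih h')

variable {e₀ : List β} [Finite α]

/-- A configuration of the machine represents a configuration of the program. -/
structure Represents (d : (machine C c e₀).Config) (x : PConfig C c) : Prop where
  state : d.state = (x.control, none)
  base : d.tape 0 = x.base
  done : IsStack (d.tape 1) x.done
  todo : IsStack (d.tape 2) x.todo

theorem Represents.step {d : (machine C c e₀).Config} {x : PConfig C c} (h : Represents d x) :
    ((machine C c e₀).step d).state.2 ≠ none ∧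
      (((machine C c e₀).step d).tape 0).head = x.next.base.head ∧
      Represents ((machine C c e₀).step ((machine C c e₀).step d)) x.next := by
  obtain ⟨q, T⟩ := d
  obtain ⟨h1, h2, h3, h4⟩ := h
  obtain ⟨qc, base, A, B⟩ := x
  simp only at h1 h2 h3 h4
  subst h1
  have e1 := h3.topOf_read
  have e2 := h4.topOf_read
  refine ⟨?_, ?_, ?_, ?_, ?_, ?_⟩
  · simp [TapeLearner.step, machine]
  · simp [TapeLearner.step, machine, PConfig.next, e1, e2, h2]
  · simp [TapeLearner.step, machine, PConfig.next, e1, e2, h2]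
  · have h := WorkTape.write_read
      ((base.write (program C c qc base.read A.head? B.head?).2.1).move
        (program C c qc base.read A.head? B.head?).2.2.1)
    simpa [TapeLearner.step, machine, PConfig.next, e1, e2, h2, WorkTape.move] using h
  · have h := h3.apply (program C c qc base.read A.head? B.head?).2.2.2.1
    simpa [TapeLearner.step, machine, PConfig.next, e1, e2, h2] using h
  · have h := h4.apply (program C c qc base.read A.head? B.head?).2.2.2.2
    simpa [TapeLearner.step, machine, PConfig.next, e1, e2, h2] using h

theorem Represents.reaches {H k : ℕ} {d : (machine C c e₀).Config} {x y : PConfig C c}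
    (h : PConfig.Reaches C c H x k y) (hd : Represents d x) (hy : y.base.head ≤ H) :
    Represents ((machine C c e₀).step^[2 * k] d) y ∧
      (∀ s < 2 * k, ((machine C c e₀).step^[s] d).state ≠ (machine C c e₀).accept) ∧
      ∀ s ≤ 2 * k, (((machine C c e₀).step^[s] d).tape 0).head ≤ H := by
  induction h generalizing d with
  | refl x =>
    refine ⟨hd, by simp, fun s hs => ?_⟩
    obtain rfl : s = 0 := by omega
    rwa [Function.iterate_zero, id, hd.base]
  | @head x k y h1 h2 h3 ih =>
    obtain ⟨s1, s2, s3⟩ := hd.step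
    obtain ⟨i1, i2, i3⟩ := ih s3 hy
    have hnext : x.next.base.head ≤ H := by
      have := i3 0 (Nat.zero_le _)
      rwa [Function.iterate_zero, id, s3.base] at this
    refine ⟨by simpa [Nat.mul_add, Function.iterate_add_apply] using i1, fun s hs => ?_,
      fun s hs => ?_⟩
    · match s with
      | 0 =>
        intro h
        have h' : (x.control, none) = ((Control.done, none) :
            Control C c × Option (StackOp (Option α) × StackOp (Option α))) :=
          hd.state.symm.trans h
        exact h1 (congrArg Prod.fst h')
      | 1 => exact fun h => s1 (congrArg Prod.snd h)
      | s + 2 => exact i2 s (by omega)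
    · match s with
      | 0 => rwa [Function.iterate_zero, id, hd.base]
      | 1 =>
        rw [Function.iterate_one, s2]
        exact hnext
      | s + 2 => exact i3 s (by omega)

end Machine

/-! ### The phases of a cycle -/

/-- The base tape with content `l` and head position `i`. -/
def baseTape {α β : Type} (l : List (LSymbol α β)) (i : ℕ) : WorkTape (LSymbol α β) where
  cells := fun k => l.getD k .blank
  head := i

theorem read_baseTape {α β : Type} (p : List (LSymbol α β)) (s : LSymbol α β)
    (r : List (LSymbol α β)) (i : ℕ) (hi : i = p.length + 1) :
    (baseTape (p ++ s :: r) i).read = some s := by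
  subst hi
  simp [WorkTape.read, baseTape]

theorem read_baseTape_end {α β : Type} (p : List (LSymbol α β)) (i : ℕ) (hi : i = p.length + 1) :
    (baseTape p i).read = some .blank := by
  subst hi
  simp [WorkTape.read, baseTape]

theorem write_baseTape {α β : Type} (p : List (LSymbol α β)) (s s' : LSymbol α β)
    (r : List (LSymbol α β)) (i : ℕ) (hi : i = p.length + 1) :
    (baseTape (p ++ s :: r) i).write s' = baseTape (p ++ s' :: r) i := by
  subst hi
  simp only [WorkTape.write, baseTape, WorkTape.mk.injEq, and_true]
  funext k
  rcases lt_trichotomy k p.length with h | rfl | h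
  · simp [Function.update_of_ne h.ne, List.getElem?_append_left h]
  · simp
  · obtain ⟨j, rfl⟩ := Nat.exists_eq_add_of_lt h
    rw [Function.update_of_ne h.ne']
    simp [List.getElem?_append_right, Nat.add_assoc]

theorem write_baseTape_end {α β : Type} (p : List (LSymbol α β)) (s : LSymbol α β) (i : ℕ)
    (hi : i = p.length + 1) : (baseTape p i).write s = baseTape (p ++ [s]) i := by
  subst hi
  simp only [WorkTape.write, baseTape, WorkTape.mk.injEq, and_true]
  funext k
  rcases lt_trichotomy k p.length with h | rfl | h
  · simp [Function.update_of_ne h.ne, List.getElem?_append_left h]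
  · simp
  · obtain ⟨j, rfl⟩ := Nat.exists_eq_add_of_lt h
    rw [Function.update_of_ne h.ne']
    simp [Nat.add_assoc]

theorem write_baseTape_end_blank {α β : Type} (p : List (LSymbol α β)) (i : ℕ)
    (hi : i = p.length + 1) : (baseTape p i).write .blank = baseTape p i := by
  rw [write_baseTape_end p _ i hi]
  simp only [baseTape, WorkTape.mk.injEq, and_true]
  funext k
  rcases lt_trichotomy k p.length with h | rfl | h
  · simp [List.getElem?_append_left h]
  · simp
  · obtain ⟨j, rfl⟩ := Nat.exists_eq_add_of_lt h
    simp [Nat.add_assoc]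

/-- The symbol for a memory cell, with a letter of a conjecture, in the midst of a cycle. -/
def cellSymbol {α β : Type} (p : Option β × Cell β) : LSymbol α β :=
  .output (p.1, some (p.2, someFlags))

/-- The cells that the first phase makes of the datum `w` and the memory `m` if at least `j` cells
are required beyond the datum. -/
def formatCells {α β : Type} (c : ℕ) : List α → List (Cell β) → ℕ → List (Cell β)
  | [], [], j => List.replicate j (none, none, none)
  | [], t :: m, j => t :: formatCells c ([] : List α) m (j - 1)
  | _ :: w, [], _ => (none, none, none) :: formatCells c w [] c
  | _ :: w, t :: m, _ => t :: formatCells c w m c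

theorem formatCells_nil {α β : Type} (c : ℕ) (m : List (Cell β)) (j : ℕ) :
    formatCells c ([] : List α) m j = padCells j m := by
  induction m generalizing j with
  | nil => simp [formatCells, padCells]
  | cons t m ih => simp [formatCells, padCells, ih, Nat.sub_sub, Nat.add_comm]

theorem formatCells_eq_padCells {α β : Type} (c : ℕ) (w : List α) (m : List (Cell β)) :
    formatCells c w m c = padCells (w.length + c) m := by
  induction w generalizing m with
  | nil => simp [formatCells_nil]
  | cons a w ih =>
    cases m with
    | nil =>
      simp [formatCells, ih, padCells, Nat.add_right_comm, List.replicate_succ]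
    | cons t m => simp [formatCells, ih, padCells, Nat.add_right_comm]

section Phases

variable {α β : Type} [Fintype β] {C : Checker α β} {c : ℕ}

section Steps

variable {q q' : Control C c} {p r : List (LSymbol α β)} {A B : List (Option α)}
  {s s' : LSymbol α β} {o o' : StackOp (Option α)} {H i : ℕ}

theorem reaches_one {t : WorkTape (LSymbol α β)} {m : Move} (hq : q ≠ .done) (hH : t.head ≤ H)
    (hp : program C c q t.read A.head? B.head? = (q', s, m, o, o')) :
    PConfig.Reaches C c H ⟨q, t, A, B⟩ 1 ⟨q', (t.write s).move m, o.apply A, o'.apply B⟩ := by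
  refine .head hq hH ?_
  simp only [PConfig.next, hp]
  exact .refl _

theorem reaches_marker {m : Move} (hq : q ≠ .done)
    (hp : program C c q none A.head? B.head? = (q', s, m, o, o')) :
    PConfig.Reaches C c H ⟨q, baseTape p 0, A, B⟩ 1
      ⟨q', (baseTape p 0).move m, o.apply A, o'.apply B⟩ :=
  reaches_one hq (Nat.zero_le _) hp

theorem reaches_right (hi : i = p.length + 1) (hq : q ≠ .done) (hH : i ≤ H)
    (hp : program C c q (some s) A.head? B.head? = (q', s', .right, o, o')) :
    PConfig.Reaches C c H ⟨q, baseTape (p ++ s :: r) i, A, B⟩ 1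
      ⟨q', baseTape (p ++ s' :: r) (i + 1), o.apply A, o'.apply B⟩ := by
  have h := reaches_one (t := baseTape (p ++ s :: r) i) hq hH (by rw [read_baseTape _ _ _ _ hi, hp])
  rwa [write_baseTape _ _ _ _ _ hi] at h

theorem reaches_left (hi : i = p.length) (hq : q ≠ .done) (hH : i + 1 ≤ H)
    (hp : program C c q (some s) A.head? B.head? = (q', s', .left, o, o')) :
    PConfig.Reaches C c H ⟨q, baseTape (p ++ s :: r) (i + 1), A, B⟩ 1
      ⟨q', baseTape (p ++ s' :: r) i, o.apply A, o'.apply B⟩ := by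
  have h := reaches_one (t := baseTape (p ++ s :: r) (i + 1)) hq hH
    (by rw [read_baseTape _ _ _ _ (by rw [hi]), hp])
  rwa [write_baseTape _ _ _ _ _ (by rw [hi])] at h

theorem reaches_append (hi : i = p.length + 1) (hq : q ≠ .done) (hH : i ≤ H)
    (hp : program C c q (some .blank) A.head? B.head? = (q', s', .right, o, o')) :
    PConfig.Reaches C c H ⟨q, baseTape p i, A, B⟩ 1
      ⟨q', baseTape (p ++ [s']) (i + 1), o.apply A, o'.apply B⟩ := by
  have h := reaches_one (t := baseTape p i) hq hH (by rw [read_baseTape_end _ _ hi, hp])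
  rwa [write_baseTape_end _ _ _ hi] at h

theorem reaches_turn (hi : i = p.length) (hq : q ≠ .done) (hH : i + 1 ≤ H)
    (hp : program C c q (some .blank) A.head? B.head? = (q', .blank, .left, o, o')) :
    PConfig.Reaches C c H ⟨q, baseTape p (i + 1), A, B⟩ 1
      ⟨q', baseTape p i, o.apply A, o'.apply B⟩ := by
  have h := reaches_one (t := baseTape p (i + 1)) hq hH
    (by rw [read_baseTape_end _ _ (by rw [hi]), hp])
  rwa [write_baseTape_end_blank _ _ (by rw [hi])] at h

end Steps

theorem format_step (f : Flags) (j : Fin (c + 1)) (x : Option α) (m : Option (Cell β × Flags))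
    (p : List (Option β × Cell β)) (r : List (LSymbol α β)) (A B : List (Option α)) (H : ℕ)
    (hH : p.length + 1 ≤ H) :
    PConfig.Reaches C c H
      ⟨.format f j, baseTape (p.map cellSymbol ++ .input (x, m) :: r) (p.length + 1), A, B⟩ 1
      ⟨.format (m.elim f Prod.snd)
        (if x.isSome then Fin.last c else ⟨j - 1, by have := j.2; omega⟩),
        baseTape ((p ++ [(none, m.elim (none, none, none) Prod.fst)]).map cellSymbol ++ r)
          (p.length + 1 + 1), x.elim A (fun a => some a :: A), B⟩ := by
  have h := reaches_right (C := C) (c := c) (p := p.map cellSymbol) (r := r) (A := A) (B := B)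
    (q := .format f j) (s := .input (x, m)) (i := p.length + 1) (by simp) (by simp) hH rfl
  cases x <;> simpa [cellSymbol, StackOp.apply] using h

theorem format_step_blank (f : Flags) (j : Fin (c + 1)) (hj : j.1 ≠ 0)
    (p : List (Option β × Cell β)) (A B : List (Option α)) (H : ℕ) (hH : p.length + 1 ≤ H) :
    PConfig.Reaches C c H
      ⟨.format f j, baseTape (p.map cellSymbol) (p.length + 1), A, B⟩ 1
      ⟨.format f ⟨j - 1, by have := j.2; omega⟩,
        baseTape ((p ++ [(none, none, none, none)]).map cellSymbol) (p.length + 1 + 1), A, B⟩ := by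
  have h := reaches_append (C := C) (c := c) (p := p.map cellSymbol) (A := A) (B := B)
    (q := .format f j) (i := p.length + 1) (by simp) (by simp) hH (if_neg hj)
  simpa [cellSymbol, StackOp.apply] using h

theorem format_reaches_replicate (f : Flags) (j : ℕ) (hj : j < c + 1)
    (p : List (Option β × Cell β)) (A B : List (Option α)) (H : ℕ) (hH : p.length + j ≤ H) :
    PConfig.Reaches C c H
      ⟨.format f ⟨j, hj⟩, baseTape (p.map cellSymbol) (p.length + 1), A, B⟩ j
      ⟨.format f 0, baseTape ((p ++ List.replicate j (none, none, none, none)).map cellSymbol)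
        (p.length + j + 1), A, B⟩ := by
  induction j generalizing p with
  | zero => simpa using .refl _
  | succ j ih =>
    have h1 := format_step_blank (C := C) f ⟨j + 1, hj⟩ (by simp) p A B H (by omega)
    have h2 := ih (by omega) (p ++ [(none, none, none, none)]) (by simp; omega)
    have h3 := h1.trans (by simpa using h2)
    simpa [Nat.add_comm, Nat.add_left_comm, List.replicate_succ] using h3

theorem format_reaches (F : Flags) (w : List α) (m : List (Cell β)) (f : Flags) (j : Fin (c + 1))
    (p : List (Option β × Cell β)) (A B : List (Option α)) (H : ℕ)
    (hH : p.length + (formatCells c w m j).length ≤ H) :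
    PConfig.Reaches C c H
      ⟨.format f j, baseTape (p.map cellSymbol ++ (conv w (m.map fun t => (t, F))).map .input)
        (p.length + 1), A, B⟩ (formatCells c w m j).length
      ⟨.format (if m.isEmpty then f else F) 0,
        baseTape ((p ++ (formatCells c w m j).map fun t => (none, t)).map cellSymbol)
        (p.length + (formatCells c w m j).length + 1), w.reverse.map some ++ A, B⟩ := by
  induction w generalizing m f j p A with
  | nil =>
    induction m generalizing f j p with
    | nil =>
      simp only [formatCells, List.length_replicate] at hH
      simpa [formatCells, conv_nil_nil] using format_reaches_replicate f j.1 j.2 p A B H hH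
    | cons t m ih =>
      simp only [formatCells, List.length_cons] at hH
      have h1 := format_step (C := C) f j none (some (t, F)) p
        ((conv ([] : List α) (m.map fun t => (t, F))).map .input) A B H (by omega)
      have h2 := ih F ⟨j - 1, by have := j.2; omega⟩ (p ++ [(none, t)]) (by simp; omega)
      have h3 := h1.trans (by simpa using h2)
      simpa [formatCells, conv_nil_cons, Nat.add_comm, Nat.add_left_comm, Nat.add_assoc] using h3
  | cons a w ih =>
    cases m with
    | nil =>
      simp only [formatCells, List.length_cons] at hH
      have h1 := format_step (C := C) f j (some a) none p
        ((conv w ([] : List (Cell β × Flags))).map .input) A B H (by omega)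
      have h2 := ih [] f (Fin.last c) (p ++ [(none, none, none, none)]) (some a :: A)
        (by simp; omega)
      have h3 := h1.trans (by simpa using h2)
      simpa [formatCells, conv_cons_nil, Nat.add_comm, Nat.add_left_comm] using h3
    | cons t m =>
      simp only [formatCells, List.length_cons] at hH
      have h1 := format_step (C := C) f j (some a) (some (t, F)) p
        ((conv w (m.map fun t => (t, F))).map .input) A B H (by omega)
      have h2 := ih m F (Fin.last c) (p ++ [(none, t)]) (some a :: A) (by simp; omega)
      have h3 := h1.trans (by simpa using h2)
      simpa [formatCells, conv_cons_cons, Nat.add_comm, Nat.add_left_comm] using h3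

end Phases

/-! ### Moving a word between the stacks -/

/-- The stack content for a list of words: each word is followed by the marker `none`. -/
def encodeStack {α : Type} : List (List α) → List (Option α)
  | [] => []
  | x :: l => x.map some ++ none :: encodeStack l

theorem head?_encodeStack_cons {α : Type} (x : List α) (l : List (List α)) :
    ∃ a, (encodeStack (x :: l)).head? = some a := by
  cases x <;> simp [encodeStack]

/-- A step of moving a word, together with its effect on the stacks. -/
def moveStep {α : Type} (x : Direction × List (Option α) × List (Option α)) :
    Direction × List (Option α) × List (Option α) :=
  ((moveLetter x.1 x.2.1.head? x.2.2.head?).1,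
    (moveLetter x.1 x.2.1.head? x.2.2.head?).2.1.apply x.2.1,
    (moveLetter x.1 x.2.1.head? x.2.2.head?).2.2.apply x.2.2)

theorem iterate_moveStep_idle {α : Type} (A B : List (Option α)) (n : ℕ) :
    moveStep^[n] (.idle, A, B) = (.idle, A, B) := by
  induction n with
  | zero => rfl
  | succ n ih =>
    rw [Function.iterate_succ_apply]
    exact ih

theorem iterate_moveStep_toTodo {α : Type} (x : List α) (A B : List (Option α)) (n : ℕ)
    (hn : x.length < n) :
    moveStep^[n] (.toTodo, x.map some ++ none :: A, B) = (.idle, A, x.reverse.map some ++ B) := by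
  induction x generalizing n B with
  | nil =>
    obtain ⟨n, rfl⟩ := Nat.exists_eq_add_of_lt hn
    rw [Function.iterate_succ_apply]
    exact iterate_moveStep_idle _ _ _
  | cons a x ih =>
    cases n with
    | zero => simp at hn
    | succ n =>
      rw [Function.iterate_succ_apply]
      have h := ih (some a :: B) n (by simpa using hn)
      simpa [moveStep, moveLetter, StackOp.apply] using h

theorem iterate_moveStep_toDone {α : Type} (x : List α) (A B : List (Option α)) (n : ℕ)
    (hn : x.length < n) :
    moveStep^[n] (.toDone, A, x.map some ++ none :: B) = (.idle, x.reverse.map some ++ A, B) := by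
  induction x generalizing n A with
  | nil =>
    obtain ⟨n, rfl⟩ := Nat.exists_eq_add_of_lt hn
    rw [Function.iterate_succ_apply]
    exact iterate_moveStep_idle _ _ _
  | cons a x ih =>
    cases n with
    | zero => simp at hn
    | succ n =>
      rw [Function.iterate_succ_apply]
      have h := ih (some a :: A) n (by simpa using hn)
      simpa [moveStep, moveLetter, StackOp.apply] using h

/-- The letters that are compared in the course of `n` steps. -/
def comparedLetters {α : Type} :
    ℕ → Direction × List (Option α) × List (Option α) → List (Option α)
  | 0, _ => []
  | n + 1, x => comparedLetter x.1 x.2.2.head? :: comparedLetters n (moveStep x)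

theorem length_comparedLetters {α : Type} (n : ℕ)
    (x : Direction × List (Option α) × List (Option α)) : (comparedLetters n x).length = n := by
  induction n generalizing x with
  | zero => rfl
  | succ n ih => simp [comparedLetters, ih]

theorem comparedLetters_idle {α : Type} (A B : List (Option α)) (n : ℕ) :
    comparedLetters n (.idle, A, B) = List.replicate n none := by
  induction n with
  | zero => rfl
  | succ n ih =>
    rw [List.replicate_succ, ← ih]
    rfl

theorem comparedLetters_toDone {α : Type} (x : List α) (A B : List (Option α)) (n : ℕ)
    (hn : x.length < n) :
    comparedLetters n (.toDone, A, x.map some ++ none :: B) =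
      x.map some ++ List.replicate (n - x.length) none := by
  induction x generalizing n A with
  | nil =>
    obtain ⟨n, rfl⟩ := Nat.exists_eq_add_of_lt hn
    have h := comparedLetters_idle A B n
    simpa [comparedLetters, comparedLetter, moveStep, moveLetter, StackOp.apply,
      List.replicate_succ] using h
  | cons a x ih =>
    cases n with
    | zero => simp at hn
    | succ n =>
      have h := ih (some a :: A) n (by simpa using hn)
      simpa [comparedLetters, comparedLetter, moveStep, moveLetter, StackOp.apply] using h

/-! ### The second, third and fourth phase -/

/-- If `live` holds, replace all entries after the first `none` by `none`, otherwise all. -/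
def truncate {γ : Type} : Bool → List (Option γ) → List (Option γ)
  | _, [] => []
  | live, a :: l => (if live then a else none) :: truncate (live && a.isSome) l

theorem length_truncate {γ : Type} (b : Bool) (l : List (Option γ)) :
    (truncate b l).length = l.length := by
  induction l generalizing b with
  | nil => rfl
  | cons a l ih => simp [truncate, ih]

theorem truncate_false {γ : Type} (l : List (Option γ)) :
    truncate false l = List.replicate l.length none := by
  induction l with
  | nil => rfl
  | cons a l ih => simp [truncate, ih, List.replicate_succ]

theorem truncate_true {γ : Type} (l : List (Option γ)) :
    ∃ k, truncate true l = (decode l).map some ++ List.replicate k none := by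
  induction l with
  | nil => exact ⟨0, rfl⟩
  | cons a l ih =>
    cases a with
    | none => exact ⟨l.length + 1, by simp [truncate, truncate_false, decode, List.replicate_succ]⟩
    | some a =>
      obtain ⟨k, hk⟩ := ih
      exact ⟨k, by simp [truncate, hk, decode]⟩

/-- The convolution of a word with a word that is at least as long. -/
theorem conv_eq_zipWith {β γ : Type} (e : List β) (k : ℕ) (o : List (Option β)) (m : List γ)
    (ho : o = e.map some ++ List.replicate k none) (hm : o.length = m.length) :
    conv e m = List.zipWith (fun a t => (a, some t)) o m := by
  subst ho
  induction e generalizing m with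
  | nil =>
    induction k generalizing m with
    | zero =>
      obtain rfl : m = [] := List.length_eq_zero_iff.1 (by simpa using hm.symm)
      rfl
    | succ k ih =>
      cases m with
      | nil => simp at hm
      | cons t m =>
        rw [conv_nil_cons, ih m (by simpa using hm)]
        simp [List.replicate_succ]
  | cons b e ih =>
    cases m with
    | nil => simp at hm
    | cons t m =>
      rw [conv_cons_cons, ih m (by simpa using hm)]
      simp

section Phases

variable {α β : Type} [Fintype β] {C : Checker α β} {c : ℕ}

theorem shift_reaches (f : Flags) (p r : List (LSymbol α β)) (d : Direction)
    (A B : List (Option α)) (H : ℕ) (hH : p.length ≤ H) :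
    PConfig.Reaches C c H ⟨.shift f d, baseTape (p ++ r) p.length, A, B⟩ p.length
      ⟨.shift f (moveStep^[p.length] (d, A, B)).1, baseTape (p ++ r) 0,
        (moveStep^[p.length] (d, A, B)).2.1, (moveStep^[p.length] (d, A, B)).2.2⟩ := by
  induction p using List.reverseRecOn generalizing r d A B with
  | nil => exact .refl _
  | append_singleton p s ih =>
    have h1 := reaches_left (C := C) (c := c) (p := p) (r := r) (A := A) (B := B) (H := H)
      (q := .shift f d) (s := s) rfl (by simp) (by simpa using hH) rfl
    have h2 := h1.trans (ih (s :: r) _ _ _ (by simp at hH; omega))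
    rw [Nat.add_comm 1] at h2
    simpa [moveStep, Function.iterate_succ_apply] using h2

theorem check_reaches (s : CheckState C) (l : List (Cell β)) (p : List (Option β × Cell β))
    (A B : List (Option α)) (H : ℕ) (hH : p.length + l.length ≤ H) :
    ∃ s' : CheckState C, s'.flags = s.flags ∧ s'.comparing = s.comparing ∧
      s'.state = (List.zipWith (fun t a => (t.1, t.2.1, a))
        (advanceCells s.hypCarry s.candCarry l) (comparedLetters l.length (s.dir, A, B))).foldl
          C.step s.state ∧
      PConfig.Reaches C c H
        ⟨.check s, baseTape ((p ++ l.map fun t => (none, t)).map cellSymbol) (p.length + 1), A, B⟩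
        l.length
        ⟨.check s', baseTape ((p ++ List.zip
            (truncate s.live ((advanceCells s.hypCarry s.candCarry l).map fun t => t.1))
            (advanceCells s.hypCarry s.candCarry l)).map cellSymbol) (p.length + l.length + 1),
          (moveStep^[l.length] (s.dir, A, B)).2.1, (moveStep^[l.length] (s.dir, A, B)).2.2⟩ := by
  induction l generalizing s p A B with
  | nil => exact ⟨s, rfl, rfl, rfl, by simpa [advanceCells, truncate] using .refl _⟩
  | cons t l ih =>
    simp only [List.length_cons] at hH
    have h1 := reaches_right (C := C) (c := c) (p := p.map cellSymbol)
      (r := (l.map fun t => (none, t)).map cellSymbol) (A := A) (B := B) (H := H)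
      (q := .check s) (s := cellSymbol (none, t)) (i := p.length + 1) (by simp) (by simp)
      (by omega) rfl
    obtain ⟨s', h2, h3, h4, h5⟩ := ih (s.next t A.head? B.head?)
      (p ++ [(if s.live then (s.cell t).1 else none, s.cell t)])
      ((moveLetter s.dir A.head? B.head?).2.1.apply A)
      ((moveLetter s.dir A.head? B.head?).2.2.apply B) (by simp; omega)
    refine ⟨s', h2, h3, ?_, ?_⟩
    · rw [h4]
      rfl
    · have h6 := h1.trans (by simpa [cellSymbol] using h5)
      simpa [advanceCells, truncate, moveStep, cellSymbol, CheckState.next, CheckState.cell,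
        Nat.add_comm, Nat.add_left_comm, Nat.add_assoc] using h6

theorem emit_reaches (f : Flags) (g : Bool) (p : List (Option β × Cell β))
    (r : List (LSymbol α β)) (A B : List (Option α)) (H : ℕ) (hH : p.length ≤ H) :
    PConfig.Reaches C c H ⟨.emit f g, baseTape (p.map cellSymbol ++ r) p.length, A, B⟩ p.length
      ⟨.emit f g, baseTape (p.map (fun t =>
        .output (if g then t.1 else t.2.2.2, some (t.2, f))) ++ r) 0, A, B⟩ := by
  induction p using List.reverseRecOn generalizing r with
  | nil => exact .refl _
  | append_singleton p t ih =>
    have h1 := reaches_left (C := C) (c := c) (p := p.map cellSymbol) (r := r) (A := A) (B := B)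
      (H := H) (q := .emit f g) (s := cellSymbol t) (i := p.length) (by simp) (by simp)
      (by simpa using hH) rfl
    have h2 := ih (.output (if g then t.1 else t.2.2.2, some (t.2, f)) :: r)
      (by simp at hH; omega)
    have h3 := h1.trans (by simpa [StackOp.apply] using h2)
    rw [Nat.add_comm 1] at h3
    simpa using h3

end Phases

/-! ### The checking automaton -/

/-- The checker answers its questions about all digit strings correctly. -/
def Checker.Decides {α β : Type} (C : Checker α β) (I : Language β)
    (J : Language (Option β × Option α)) : Prop :=
  ∀ z : List (Option β × Option β × Option α),
    (C.isIndex (z.foldl C.step C.start) = true ↔ decode (z.map fun t => t.1) ∈ I) ∧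
    (C.beats (z.foldl C.step C.start) = true ↔
      fiber J (decode (z.map fun t => t.2.1)) ⊂ fiber J (decode (z.map fun t => t.1))) ∧
    (C.memHyp (z.foldl C.step C.start) = true ↔
      decode (z.map fun t => t.2.2) ∈ fiber J (decode (z.map fun t => t.1))) ∧
    (C.memCand (z.foldl C.step C.start) = true ↔
      decode (z.map fun t => t.2.2) ∈ fiber J (decode (z.map fun t => t.2.1)))

theorem exists_checker {α β : Type} {I : Language β} {J : Language (Option β × Option α)}
    (hI : I.IsRegular) (hJ : J.IsRegular) : ∃ C : Checker α β, C.Decides I J := by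
  classical
  obtain ⟨σ₁, _, D₁, h₁⟩ := isRegular_preimage_map (isRegular_decode_mem hI)
    (fun t : Option β × Option β × Option α => t.1)
  obtain ⟨σ₂, _, D₂, h₂⟩ := isRegular_preimage_map (isRegular_fiber_ssubset hJ)
    (fun t : Option β × Option β × Option α => (t.2.1, t.1))
  obtain ⟨σ₃, _, D₃, h₃⟩ := isRegular_preimage_map (isRegular_conv_decode_mem hJ)
    (fun t : Option β × Option β × Option α => (t.1, t.2.2))
  obtain ⟨σ₄, _, D₄, h₄⟩ := isRegular_preimage_map (isRegular_conv_decode_mem hJ)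
    (fun t : Option β × Option β × Option α => (t.2.1, t.2.2))
  let C : Checker α β :=
    { State := σ₁ × σ₂ × σ₃ × σ₄
      start := (D₁.start, D₂.start, D₃.start, D₄.start)
      step := fun q t => (D₁.step q.1 t, D₂.step q.2.1 t, D₃.step q.2.2.1 t, D₄.step q.2.2.2 t)
      isIndex := fun q => decide (q.1 ∈ D₁.accept)
      beats := fun q => decide (q.2.1 ∈ D₂.accept)
      memHyp := fun q => decide (q.2.2.1 ∈ D₃.accept)
      memCand := fun q => decide (q.2.2.2 ∈ D₄.accept) }
  have hfold : ∀ (z : List (Option β × Option β × Option α)) q₁ q₂ q₃ q₄,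
      z.foldl C.step (q₁, q₂, q₃, q₄) =
        (D₁.evalFrom q₁ z, D₂.evalFrom q₂ z, D₃.evalFrom q₃ z, D₄.evalFrom q₄ z) := by
    intro z
    induction z with
    | nil => exact fun _ _ _ _ => rfl
    | cons t z ih => exact fun _ _ _ _ => ih _ _ _ _
  refine ⟨C, fun z => ?_⟩
  have e₁ := Set.ext_iff.1 h₁ z
  have e₂ := Set.ext_iff.1 h₂ z
  have e₃ := Set.ext_iff.1 h₃ z
  have e₄ := Set.ext_iff.1 h₄ z
  change D₁.evalFrom D₁.start z ∈ D₁.accept ↔ decode (z.map _) ∈ I at e₁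
  change D₂.evalFrom D₂.start z ∈ D₂.accept ↔ fiber J (decode ((z.map _).map _)) ⊂
    fiber J (decode ((z.map _).map _)) at e₂
  change D₃.evalFrom D₃.start z ∈ D₃.accept ↔ conv (decode ((z.map _).map _))
    (decode ((z.map _).map _)) ∈ J at e₃
  change D₄.evalFrom D₄.start z ∈ D₄.accept ↔ conv (decode ((z.map _).map _))
    (decode ((z.map _).map _)) ∈ J at e₄
  simp only [List.map_map] at e₂ e₃ e₄
  have hz : z.foldl C.step C.start = (D₁.evalFrom D₁.start z, D₂.evalFrom D₂.start z,
    D₃.evalFrom D₃.start z, D₄.evalFrom D₄.start z) := hfold z _ _ _ _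
  rw [hz]
  exact ⟨decide_eq_true_iff.trans e₁, decide_eq_true_iff.trans e₂, decide_eq_true_iff.trans e₃,
    decide_eq_true_iff.trans e₄⟩

/-! ### A cycle of the machine -/

namespace Stage

variable {α β : Type}

/-- The flags in the memory. -/
noncomputable def flags (J : Language (Option β × Option α)) (S : Stage α β) : Flags :=
  ⟨S.checking, S.hypOk, S.candOk, S.beats J⟩

/-- The long term memory: each cell carries a copy of the flags. -/
noncomputable def memory (J : Language (Option β × Option α)) (S : Stage α β) :
    List (Cell β × Flags) :=
  S.cells.map fun t => (t, S.flags J)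

open Classical in
/-- The conjecture: the hypothesis, if that is an index, and the fallback `e₀` otherwise. -/
noncomputable def conjecture (I : Language β) (e₀ : List β) (S : Stage α β) : List β :=
  if S.hyp ∈ I then S.hyp else e₀

/-- The content of the stack of the words that are done. They are stored with the last letter on
top, the words to do with the first one. -/
def doneStack (S : Stage α β) : List (Option α) := encodeStack (S.done.map List.reverse)

/-- The content of the stack of the words to do. -/
def todoStack (S : Stage α β) : List (Option α) := encodeStack S.todo

end Stage

theorem output_eq_conv {α β : Type} (l : List (Cell β)) (e₀ : List β) (k : ℕ)
    (hk : l.map (fun t => t.2.2) = e₀.map some ++ List.replicate k none) (g : Bool) (f : Flags) :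
    ((List.zip (truncate true (l.map fun t => t.1)) l).map fun t =>
      (.output (if g then t.1 else t.2.2.2, some (t.2, f)) : LSymbol α β)) =
    (conv (if g then decode (l.map fun t => t.1) else e₀) (l.map fun t => (t, f))).map .output := by
  cases g with
  | true =>
    obtain ⟨k', hk'⟩ := truncate_true (l.map fun t => t.1)
    simp only [if_true]
    rw [conv_eq_zipWith _ k' _ _ hk' (by simp [length_truncate])]
    simp [List.zip, List.map_zipWith, List.zipWith_map_right]
  | false =>
    simp only [Bool.false_eq_true, if_false]
    rw [conv_eq_zipWith e₀ k _ _ hk (by simp)]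
    have h : (List.zip (truncate true (l.map fun t => t.1)) l).map Prod.snd = l :=
      List.map_snd_zip (by simp [length_truncate])
    have h' := congrArg (List.map fun t : Cell β =>
      (.output (t.2.2, some (t, f)) : LSymbol α β)) h
    rw [List.map_map] at h'
    simp only [List.zipWith_map, List.zipWith_self, List.map_map]
    exact h'

theorem map_zipWith_left {X Y Z T : Type} {l : List X} {u : List Y} (f : X → Y → Z) (g : Z → T)
    (h : X → T) (hfg : ∀ x y, g (f x y) = h x) (hlen : l.length ≤ u.length) :
    (List.zipWith f l u).map g = l.map h := by
  induction l generalizing u with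
  | nil => simp
  | cons x l ih =>
    cases u with
    | nil => simp at hlen
    | cons y u => simp [hfg, ih (by simpa using hlen)]

theorem map_zipWith_right {X Y Z T : Type} {l : List X} {u : List Y} (f : X → Y → Z) (g : Z → T)
    (h : Y → T) (hfg : ∀ x y, g (f x y) = h y) (hlen : u.length ≤ l.length) :
    (List.zipWith f l u).map g = u.map h := by
  induction u generalizing l with
  | nil => simp
  | cons y u ih =>
    cases l with
    | nil => simp at hlen
    | cons x l => simp [hfg, ih (by simpa using hlen)]

section Cycle

variable {α β : Type} [Fintype β] {C : Checker α β} {c : ℕ}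

/-- The first two phases. -/
theorem begin_reaches (f : Flags) (x : List α) (l : List (Cell β)) (hl : l ≠ []) (hc : 0 < c)
    (A B : List (Option α)) (H : ℕ) (hH : (padCells (x.length + c) l).length + 1 ≤ H) :
    PConfig.Reaches C c H
      ⟨.format someFlags (Fin.last c), baseTape ((conv x (l.map fun t => (t, f))).map .input) 0,
        A, B⟩ (2 * (padCells (x.length + c) l).length + 2)
      ⟨.shift f .idle,
        baseTape (((padCells (x.length + c) l).map fun t => (none, t)).map cellSymbol) 0,
        if f.checking then x.reverse.map some ++ none :: A else A,
        if f.checking then B else x.map some ++ none :: B⟩ := by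
  have h1 := reaches_marker (C := C) (c := c) (p := (conv x (l.map fun t => (t, f))).map .input)
    (A := A) (B := B) (H := H) (q := .format someFlags (Fin.last c)) (by simp) rfl
  have hF : formatCells c x l (Fin.last c : Fin (c + 1)).1 = padCells (x.length + c) l :=
    formatCells_eq_padCells c x l
  have h2 := format_reaches (C := C) f x l someFlags (Fin.last c) [] (none :: A) B H
    (by rw [hF]; simp; omega)
  rw [hF] at h2
  have hl' : l.isEmpty = false := by simpa using hl
  rw [hl'] at h2
  have hlen : x.length < (padCells (x.length + c) l).length := by
    rw [length_padCells]
    omega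
  generalize padCells (x.length + c) l = l' at *
  have h3 := h1.trans h2
  cases hf : f.checking with
  | true =>
    have h4 := reaches_turn (C := C) (c := c) (p := (l'.map fun t => (none, t)).map cellSymbol)
      (A := x.reverse.map some ++ none :: A) (B := B) (H := H) (q := .format f 0)
      (q' := .shift f .idle) (o := .keep) (o' := .keep) (i := l'.length) (by simp) (by simp) hH
      (by simp [program, hf])
    have h5 := shift_reaches (C := C) (c := c) f ((l'.map fun t => (none, t)).map cellSymbol) []
      .idle (x.reverse.map some ++ none :: A) B H (by simp; omega)
    simp only [List.length_map, List.append_nil, iterate_moveStep_idle] at h5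
    have h6 := (h3.trans (by simpa [StackOp.apply] using h4)).trans h5
    convert h6 using 1
    · omega
    · simp
  | false =>
    have h4 := reaches_turn (C := C) (c := c) (p := (l'.map fun t => (none, t)).map cellSymbol)
      (A := x.reverse.map some ++ none :: A) (B := B) (H := H) (q := .format f 0)
      (q' := .shift f .toTodo) (o := .keep) (o' := .push none) (i := l'.length) (by simp)
      (by simp) hH (by simp [program, hf])
    have h5 := shift_reaches (C := C) (c := c) f ((l'.map fun t => (none, t)).map cellSymbol) []
      .toTodo (x.reverse.map some ++ none :: A) (none :: B) H (by simp; omega)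
    simp only [List.length_map, List.append_nil] at h5
    rw [iterate_moveStep_toTodo _ _ _ _ (by simpa using hlen), List.reverse_reverse] at h5
    have h6 := (h3.trans (by simpa [StackOp.apply] using h4)).trans h5
    convert h6 using 1
    · omega
    · simp

/-- The last two phases. -/
theorem finish_reaches (f : Flags) (l : List (Cell β)) (A B : List (Option α)) (H : ℕ)
    (hH : l.length + 1 ≤ H) (s : CheckState C) (o o' : StackOp (Option α))
    (hs : beginCheck C f A.head? B.head? = (s, o, o')) (hlive : s.live = true)
    (hstart : s.state = C.start) (l' : List (Cell β))
    (hl' : advanceCells s.hypCarry s.candCarry l = l') (q : C.State)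
    (hq : (List.zipWith (fun t a => (t.1, t.2.1, a)) l'
        (comparedLetters l.length (s.dir, o.apply A, o'.apply B))).foldl C.step C.start = q)
    (d : Direction) (A' B' : List (Option α))
    (hm : moveStep^[l.length] (s.dir, o.apply A, o'.apply B) = (d, A', B')) (f' : Flags)
    (hf' : f' = ⟨s.flags.checking, s.flags.hypOk && (!s.comparing || C.memHyp q),
      s.flags.candOk && (!s.comparing || C.memCand q), C.beats q⟩) :
    PConfig.Reaches C c H
      ⟨.shift f .idle, baseTape ((l.map fun t => (none, t)).map cellSymbol) 0, A, B⟩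
      (2 * l.length + 3)
      ⟨.done, baseTape ((List.zip (truncate true (l'.map fun t => t.1)) l').map fun t =>
        .output (if C.isIndex q then t.1 else t.2.2.2, some (t.2, f'))) 0, A', B'⟩ := by
  subst hl' hq hf'
  have h1 := reaches_marker (C := C) (c := c) (p := (l.map fun t => (none, t)).map cellSymbol)
    (A := A) (B := B) (H := H) (q := .shift f .idle) (q' := .check s) (s := .blank) (m := .right)
    (o := o) (o' := o') (by simp) (by simp [program, hs])
  obtain ⟨s', h2, h3, h4, h5⟩ := check_reaches (C := C) (c := c) s l [] (o.apply A) (o'.apply B) H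
    (by simp; omega)
  rw [hm, hlive] at h5
  rw [hstart] at h4
  simp only [List.nil_append, List.length_nil, Nat.zero_add] at h5
  have hlen : (List.zip (truncate true ((advanceCells s.hypCarry s.candCarry l).map fun t => t.1))
      (advanceCells s.hypCarry s.candCarry l)).length = l.length := by
    simp [length_truncate, length_advanceCells]
  have h6 := reaches_turn (C := C) (c := c) (p := (List.zip (truncate true
      ((advanceCells s.hypCarry s.candCarry l).map fun t => t.1))
      (advanceCells s.hypCarry s.candCarry l)).map cellSymbol) (A := A') (B := B') (H := H)
    (q := .check s') (i := l.length) (by simp [hlen]) (by simp) hH rfl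
  have h7 := emit_reaches (C := C) (c := c) s'.finalFlags (C.isIndex s'.state) (List.zip (truncate
      true ((advanceCells s.hypCarry s.candCarry l).map fun t => t.1))
      (advanceCells s.hypCarry s.candCarry l)) [] A' B' H (by rw [hlen]; omega)
  rw [hlen] at h7
  simp only [List.append_nil] at h7
  have h8 := reaches_marker (C := C) (c := c) (p := (List.zip (truncate true
      ((advanceCells s.hypCarry s.candCarry l).map fun t => t.1))
      (advanceCells s.hypCarry s.candCarry l)).map fun t =>
        .output (if C.isIndex s'.state then t.1 else t.2.2.2, some (t.2, s'.finalFlags)))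
    (A := A') (B := B') (H := H) (q := .emit s'.finalFlags (C.isIndex s'.state)) (by simp) rfl
  have h9 := (((h1.trans h5).trans h6).trans h7).trans h8
  have hk : 1 + l.length + 1 + l.length + 1 = 2 * l.length + 3 := by omega
  rw [hk] at h9
  simp only [CheckState.finalFlags, h2, h3, h4] at h9
  exact h9

/-- A cycle of the program performs a step of the learning procedure. -/
theorem cycle_reaches {I : Language β} {J : Language (Option β × Option α)} (hC : C.Decides I J)
    (S : Stage α β) (x : List α) (hc : 0 < c) (hcells : S.cells ≠ [])
    (hwords : ∀ y, y ∈ S.done ∨ y ∈ S.todo → y.length < S.cells.length) (e₀ : List β) (k : ℕ)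
    (hk : S.cells.map (fun t => t.2.2) = e₀.map some ++ List.replicate k none) (H : ℕ)
    (hH : (S.nextCells J c x).length + 1 ≤ H) :
    PConfig.Reaches C c H
      ⟨.format someFlags (Fin.last c), baseTape ((conv x (S.memory J)).map .input) 0,
        S.doneStack, S.todoStack⟩ (4 * (S.nextCells J c x).length + 5)
      ⟨.done, baseTape ((conv ((S.next J c x).conjecture I e₀) ((S.next J c x).memory J)).map
        .output) 0, (S.next J c x).doneStack, (S.next J c x).todoStack⟩ := by
  classical
  have hN : (padCells (x.length + c) S.cells).length = (S.nextCells J c x).length := by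
    rw [Stage.nextCells, length_advanceCells]
  have hx : x.length < (S.nextCells J c x).length := by
    rw [Stage.length_nextCells]
    omega
  have hw : ∀ y, y ∈ S.done ∨ y ∈ S.todo → y.length < (S.nextCells J c x).length := by
    intro y hy
    have := hwords y hy
    rw [Stage.length_nextCells]
    omega
  have hfb := S.map_snd_snd_nextCells J c x
  rw [hk, List.append_assoc, List.replicate_append_replicate] at hfb
  have h1 := begin_reaches (C := C) (S.flags J) x S.cells hcells hc S.doneStack S.todoStack H
    (by omega)
  -- The remaining phases, for each of the ways in which the third phase can begin.
  have h2 : ∀ (A B : List (Option α)) (s : CheckState C) (o o' : StackOp (Option α)),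
      beginCheck C (S.flags J) A.head? B.head? = (s, o, o') → s.live = true → s.state = C.start →
      s.hypCarry = S.refuted J → s.candCarry = S.passEnds →
      ∀ d A' B', moveStep^[(S.nextCells J c x).length] (s.dir, o.apply A, o'.apply B) =
        (d, A', B') →
      (∀ q : C.State, (C.memHyp q = true ↔ decode (comparedLetters (S.nextCells J c x).length
          (s.dir, o.apply A, o'.apply B)) ∈ fiber J (S.next J c x).hyp) →
        (C.memCand q = true ↔ decode (comparedLetters (S.nextCells J c x).length
          (s.dir, o.apply A, o'.apply B)) ∈ fiber J (S.next J c x).cand) →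
        s.flags.checking = (S.next J c x).checking ∧
        (s.flags.hypOk && (!s.comparing || C.memHyp q)) = (S.next J c x).hypOk ∧
        (s.flags.candOk && (!s.comparing || C.memCand q)) = (S.next J c x).candOk) →
      PConfig.Reaches C c H
        ⟨.shift (S.flags J) .idle, baseTape (((padCells (x.length + c) S.cells).map
          fun t => (none, t)).map cellSymbol) 0, A, B⟩ (2 * (S.nextCells J c x).length + 3)
        ⟨.done, baseTape ((conv ((S.next J c x).conjecture I e₀) ((S.next J c x).memory J)).map
          .output) 0, A', B'⟩ := by
    intro A B s o o' hs hlive hstart hcar hcar' d A' B' hm hflags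
    have hl' : advanceCells s.hypCarry s.candCarry (padCells (x.length + c) S.cells) =
        S.nextCells J c x := by
      rw [hcar, hcar', Stage.nextCells]
    obtain ⟨q, hq⟩ : ∃ q, (List.zipWith (fun t a => (t.1, t.2.1, a)) (S.nextCells J c x)
        (comparedLetters (S.nextCells J c x).length
          (s.dir, o.apply A, o'.apply B))).foldl C.step C.start = q := ⟨_, rfl⟩
    have hdec := hC (List.zipWith (fun t a => (t.1, t.2.1, a)) (S.nextCells J c x)
        (comparedLetters (S.nextCells J c x).length (s.dir, o.apply A, o'.apply B)))
    have hlen := length_comparedLetters (S.nextCells J c x).length (s.dir, o.apply A, o'.apply B)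
    rw [hq] at hdec
    have hq' : (List.zipWith (fun t a => (t.1, t.2.1, a)) (S.nextCells J c x)
        (comparedLetters (padCells (x.length + c) S.cells).length
          (s.dir, o.apply A, o'.apply B))).foldl C.step C.start = q := by rw [hN]; exact hq
    generalize comparedLetters (S.nextCells J c x).length (s.dir, o.apply A, o'.apply B) = u at *
    have hz1 : (List.zipWith (fun (t : Cell β) a => (t.1, t.2.1, a)) (S.nextCells J c x) u).map
        (fun t => t.1) = (S.nextCells J c x).map fun t => t.1 :=
      map_zipWith_left _ _ _ (fun _ _ => rfl) hlen.ge
    have hz2 : (List.zipWith (fun (t : Cell β) a => (t.1, t.2.1, a)) (S.nextCells J c x) u).map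
        (fun t => t.2.1) = (S.nextCells J c x).map fun t => t.2.1 :=
      map_zipWith_left _ _ _ (fun _ _ => rfl) hlen.ge
    have hz3 : (List.zipWith (fun (t : Cell β) a => (t.1, t.2.1, a)) (S.nextCells J c x) u).map
        (fun t => t.2.2) = u := by
      have h := map_zipWith_right (l := S.nextCells J c x) (u := u)
        (fun (t : Cell β) a => (t.1, t.2.1, a)) (fun t => t.2.2) id (fun _ _ => rfl) hlen.le
      rwa [List.map_id] at h
    rw [hz1, hz2, hz3, ← Stage.cells_next, ← Stage.hyp, ← Stage.cand] at hdec
    obtain ⟨d1, d2, d3, d4⟩ := hdec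
    obtain ⟨f1, f2, f3⟩ := hflags q d3 d4
    have hf' : (S.next J c x).flags J = ⟨s.flags.checking, s.flags.hypOk &&
        (!s.comparing || C.memHyp q), s.flags.candOk && (!s.comparing || C.memCand q),
        C.beats q⟩ := by
      rw [f1, f2, f3, Stage.flags]
      congr 1
      rw [Bool.eq_iff_iff, d2, Stage.beats, decide_eq_true_iff]
    have h3 := finish_reaches (C := C) (c := c) (S.flags J) (padCells (x.length + c) S.cells) A B H
      (by omega) s o o' hs hlive hstart _ hl' q hq' d A' B' (by rw [hN]; exact hm) _ hf'
    rw [output_eq_conv _ _ _ hfb, hN] at h3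
    have hconj : (if C.isIndex q then decode ((S.nextCells J c x).map fun t => t.1) else e₀) =
        (S.next J c x).conjecture I e₀ := by
      rw [Stage.conjecture, Stage.hyp, Stage.cells_next]
      rw [Stage.hyp, Stage.cells_next] at d1
      simp only [d1]
    rw [hconj, ← Stage.cells_next] at h3
    rw [Stage.memory]
    simpa only [Stage.cells_next] using h3
  rw [hN] at h1
  have hk' : 4 * (S.nextCells J c x).length + 5 =
      (2 * (S.nextCells J c x).length + 2) + (2 * (S.nextCells J c x).length + 3) := by omega
  rw [hk']
  refine h1.trans ?_
  generalize (S.nextCells J c x).length = N at *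
  obtain ⟨ch, hok, cok, cells, done, todo⟩ := S
  cases ch with
  | false =>
    cases done with
    | nil =>
      refine h2 _ _ _ _ _ (by rfl) rfl rfl rfl rfl _ _ _ (iterate_moveStep_idle _ _ _)
        fun q _ _ => ?_
      simp [Stage.next, Stage.flags]
    | cons a done =>
      obtain ⟨b, hb⟩ := head?_encodeStack_cons a.reverse (done.map List.reverse)
      have hm := iterate_moveStep_toTodo a.reverse (encodeStack (done.map List.reverse))
        (none :: (x.map some ++ none :: encodeStack todo)) N
        (by simpa using hw a (by simp))
      rw [List.reverse_reverse] at hm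
      refine h2 _ _ ⟨⟨false, hok, cok, false⟩, .toTodo, false, false, false, true, C.start⟩ .keep
        (.push none) ?_ rfl rfl rfl rfl _ _ _ hm fun q _ _ => ?_
      · change beginCheck C _ (encodeStack (a.reverse :: done.map List.reverse)).head? _ = _
        rw [hb]
        rfl
      · simp [Stage.next]
  | true =>
    cases todo with
    | nil =>
      refine h2 _ _ ⟨⟨false, true, true, false⟩, .idle, false, _, true, true, C.start⟩ .keep .keep
        (by rfl) rfl rfl ?_ rfl _ _ _ (iterate_moveStep_idle _ _ _) fun q _ _ => ?_
      · simp [Stage.refuted, Stage.passEnds, Stage.flags]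
      · simp [Stage.next]
    | cons y todo =>
      obtain ⟨b, hb⟩ := head?_encodeStack_cons y todo
      have hy := hw y (by simp)
      have hm := iterate_moveStep_toDone y (none :: (x.reverse.map some ++ none ::
        encodeStack (done.map List.reverse))) (encodeStack todo) N hy
      have hl := comparedLetters_toDone y (none :: (x.reverse.map some ++ none ::
        encodeStack (done.map List.reverse))) (encodeStack todo) N hy
      refine h2 _ _ ⟨⟨true, hok, cok, false⟩, .toDone, true, false, false, true, C.start⟩
        (.push none) .keep ?_ rfl rfl rfl rfl _ _ _ hm fun q hq hq' => ?_
      · change beginCheck C _ _ (encodeStack (y :: todo)).head? = _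
        rw [hb]
        rfl
      · have hl' := congrArg decode hl
        rw [decode_map_some_append_replicate] at hl'
        have hq := hq.trans (iff_of_eq (congrArg (· ∈ _) hl'))
        have hq' := hq'.trans (iff_of_eq (congrArg (· ∈ _) hl'))
        rw [Stage.hyp_next J c x _ rfl] at hq
        rw [Stage.cand_next J c x _ rfl] at hq'
        refine ⟨rfl, ?_, ?_⟩
        · change (hok && C.memHyp q) = (hok && _)
          congr 1
          rw [Bool.eq_iff_iff, hq, decide_eq_true_iff]
        · change (cok && C.memCand q) = (cok && _)
          congr 1
          rw [Bool.eq_iff_iff, hq', decide_eq_true_iff]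

end Cycle

/-! ### The learner -/

theorem longestDatum_mono {α : Type} (w : ℕ → List α) : Monotone (longestDatum w) := fun _ _ h =>
  Finset.sup_mono (Finset.range_mono h)

theorem length_le_longestDatum {α : Type} (w : ℕ → List α) {i n : ℕ} (h : i < n) :
    (w i).length ≤ longestDatum w n :=
  Finset.le_sup (f := fun i => (w i).length) (Finset.mem_range.2 h)

section Machine

variable {α β : Type} [Fintype β] [Finite α] {C : Checker α β} {c : ℕ}

theorem exists_cycle {I : Language β} {J : Language (Option β × Option α)} (hC : C.Decides I J)
    (S : Stage α β) (x : List α) (hc : 0 < c) (hcells : S.cells ≠ [])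
    (hwords : ∀ y, y ∈ S.done ∨ y ∈ S.todo → y.length < S.cells.length) (e₀ : List β) (k : ℕ)
    (hk : S.cells.map (fun t => t.2.2) = e₀.map some ++ List.replicate k none)
    (T : Fin 2 → WorkTape (LSymbol α β)) (hd : IsStack (T 0) S.doneStack)
    (ht : IsStack (T 1) S.todoStack) :
    ∃ T' : Fin 2 → WorkTape (LSymbol α β),
      IsStack (T' 0) (S.next J c x).doneStack ∧ IsStack (T' 1) (S.next J c x).todoStack ∧
      (machine C c e₀).Cycle x (S.memory J) T (2 * (4 * (S.nextCells J c x).length + 5))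
        ((S.next J c x).conjecture I e₀) ((S.next J c x).memory J) T' ∧
      ∀ s ≤ 2 * (4 * (S.nextCells J c x).length + 5),
        (((machine C c e₀).step^[s] ((machine C c e₀).cycleStart x (S.memory J) T)).tape 0).head ≤
          (S.nextCells J c x).length + 1 := by
  have h := cycle_reaches (C := C) (c := c) hC S x hc hcells hwords e₀ k hk _ le_rfl
  have hstart : Represents ((machine C c e₀).cycleStart x (S.memory J) T)
      ⟨.format someFlags (Fin.last c), baseTape ((conv x (S.memory J)).map .input) 0,
        S.doneStack, S.todoStack⟩ := ⟨rfl, rfl, hd, ht⟩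
  obtain ⟨h1, h2, h3⟩ := hstart.reaches h (Nat.zero_le _)
  refine ⟨fun i => ((machine C c e₀).step^[2 * (4 * (S.nextCells J c x).length + 5)]
    ((machine C c e₀).cycleStart x (S.memory J) T)).tape i.succ, h1.done, h1.todo,
    ⟨h1.state, h2, ?_, fun _ => rfl⟩, h3⟩
  rw [h1.base]
  exact fun _ _ => rfl

theorem initialMemory_eq (J : Language (Option β × Option α)) (e₀ : List β) :
    (machine C c e₀).initialMemory = (Stage.initial c e₀ : Stage α β).memory J := by
  have h : (Stage.initial c e₀ : Stage α β).beats J = false := by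
    have h' : (Stage.initial c e₀ : Stage α β).cand = (Stage.initial c e₀ : Stage α β).hyp := by
      simp [Stage.cand, Stage.hyp, Stage.initial, padCells, Function.comp_def]
    rw [Stage.beats, h']
    simp
  rw [Stage.memory, Stage.flags, h]
  rfl

/-- On all data, the machine follows the learning procedure within the resource bounds. -/
theorem exists_run {I : Language β} {J : Language (Option β × Option α)} (hC : C.Decides I J)
    (hc : 0 < c) (e₀ : List β) (he₀ : e₀.length ≤ c) (w : ℕ → List α) :
    ∃ r : (machine C c e₀).Run w, r.ObeysBounds (8 * c + 18) ∧
      ∀ n, r.conjecture n = (Stage.run J c e₀ w (n + 1)).conjecture I e₀ := by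
  have hlen := Stage.length_cells_run J c e₀ w he₀
  have hcyc : ∀ (n : ℕ) (T : Fin 2 → WorkTape (LSymbol α β)),
      IsStack (T 0) (Stage.run J c e₀ w n).doneStack →
      IsStack (T 1) (Stage.run J c e₀ w n).todoStack → _ := fun n T h0 h1 =>
    exists_cycle hC (Stage.run J c e₀ w n) (w n) hc
      (List.ne_nil_of_length_pos (by rw [hlen]; omega))
      (fun y hy => by
        obtain ⟨i, hi, rfl⟩ := (Stage.mem_run J c e₀ w n y).1 hy
        have := length_le_longestDatum w hi
        rw [hlen]
        omega)
      e₀ _ (Stage.map_snd_snd_cells_run J c e₀ w n).choose_spec T h0 h1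
  let T : (n : ℕ) → {T : Fin 2 → WorkTape (LSymbol α β) //
      IsStack (T 0) (Stage.run J c e₀ w n).doneStack ∧
      IsStack (T 1) (Stage.run J c e₀ w n).todoStack} := fun n =>
    Nat.rec ⟨fun _ => WorkTape.ofWord .blank [], ⟨rfl, fun p a r h => by
        simp [Stage.doneStack, Stage.run, Stage.initial, encodeStack] at h⟩, ⟨rfl, fun p a r h => by
        simp [Stage.todoStack, Stage.run, Stage.initial, encodeStack] at h⟩⟩
      (fun n T => ⟨(hcyc n T.1 T.2.1 T.2.2).choose, (hcyc n T.1 T.2.1 T.2.2).choose_spec.1,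
        (hcyc n T.1 T.2.1 T.2.2).choose_spec.2.1⟩) n
  have hT := fun n => (hcyc n (T n).1 (T n).2.1 (T n).2.2).choose_spec.2.2
  have hN : ∀ n, (Stage.nextCells J c (w n) (Stage.run J c e₀ w n)).length =
      longestDatum w (n + 1) + c := fun n => by
    rw [← hlen, Stage.run, Stage.cells_next]
  let r : (machine C c e₀).Run w :=
    { memory := fun n => (Stage.run J c e₀ w n).memory J
      tapes := fun n => (T n).1
      time := fun n => 2 * (4 * (Stage.nextCells J c (w n) (Stage.run J c e₀ w n)).length + 5)
      conjecture := fun n => (Stage.run J c e₀ w (n + 1)).conjecture I e₀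
      memory_zero := (initialMemory_eq J e₀).symm
      tapes_zero := fun _ => rfl
      cycle := fun n => (hT n).1 }
  refine ⟨r, fun n => ⟨?_, fun s hs => ?_, ?_, ?_⟩, fun n => rfl⟩
  · change 2 * (4 * (Stage.nextCells J c (w n) (Stage.run J c e₀ w n)).length + 5) ≤
      (8 * c + 18) * ((conv (w n) ((Stage.run J c e₀ w n).memory J)).length + 1)
    rw [length_conv, Stage.length_nextCells, Stage.memory, List.length_map]
    have h : max (Stage.run J c e₀ w n).cells.length ((w n).length + c) ≤
        max (w n).length (Stage.run J c e₀ w n).cells.length + c := by omega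
    generalize max (w n).length (Stage.run J c e₀ w n).cells.length = a at *
    nlinarith [Nat.zero_le (c * a)]
  · have := (hT n).2 s hs
    rw [hN] at this
    exact this.trans (by omega)
  · change ((Stage.run J c e₀ w (n + 1)).memory J).length ≤ _
    rw [Stage.memory, List.length_map, hlen]
    omega
  · change ((Stage.run J c e₀ w (n + 1)).conjecture I e₀).length ≤ _
    have h := length_decode_le ((Stage.run J c e₀ w (n + 1)).cells.map fun t => t.1)
    rw [List.length_map, hlen] at h
    rw [Stage.conjecture]
    split_ifs
    · exact h.trans (by omega)
    · omega

end Machine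

/-- On a text for one of the languages, the memory eventually has space for an index of it. -/
theorem exists_index_of_space {α β : Type} {I : Language β} {J : Language (Option β × Option α)}
    {c : ℕ} (hshort : ∀ e ∈ I, ∀ N : ℕ, (∀ x ∈ fiber J e, x.length ≤ N) →
      ∃ d ∈ I, fiber J d = fiber J e ∧ d.length ≤ N + c) (e : List β) (he : e ∈ I)
    (w : ℕ → List α) (hw : ∀ y ∈ fiber J e, ∃ n, w n = y) :
    ∃ d ∈ I, fiber J d = fiber J e ∧
      ∀ᶠ n in Filter.atTop, d.length ≤ longestDatum w n + c := by
  by_cases h : ∃ n, e.length ≤ longestDatum w n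
  · obtain ⟨n, hn⟩ := h
    exact ⟨e, he, rfl, Filter.eventually_atTop.2 ⟨n, fun m hm =>
      (hn.trans (longestDatum_mono w hm)).trans (Nat.le_add_right _ _)⟩⟩
  · push Not at h
    have hbdd : BddAbove (Set.range (longestDatum w)) :=
      ⟨e.length, by rintro _ ⟨n, rfl⟩; exact (h n).le⟩
    obtain ⟨n, hn⟩ := Nat.sSup_mem (Set.range_nonempty (longestDatum w)) hbdd
    obtain ⟨d, hd, hde, hlen⟩ := hshort e he (longestDatum w n) fun x hx => by
      obtain ⟨i, rfl⟩ := hw x hx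
      rw [hn]
      exact (length_le_longestDatum w (Nat.lt_succ_self i)).trans (le_csSup hbdd ⟨i + 1, rfl⟩)
    exact ⟨d, hd, hde, Filter.eventually_atTop.2 ⟨n, fun m hm =>
      hlen.trans (Nat.add_le_add_right (longestDatum_mono w hm) _)⟩⟩

theorem theorem3p6 {α β : Type} [Fintype α] [Fintype β] [Primcodable α] [Primcodable β]
    (I : Language β) (L : List β → Language α)
    (hne : ∀ e ∈ I, ∃ x : List α, x ∈ L e)
    (hauto : IsAutomaticFamily I L)
    (hlearn : IsLearnable I L) :
    ∃ M : TapeLearner α β 2, M.IsLinearTimeLearnerOf I L := by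
  obtain ⟨hI, hJ⟩ := hauto
  obtain ⟨σ, _, U, m₀, _, hU⟩ := hlearn
  obtain ⟨J, hJdef⟩ : ∃ J : Language (Option β × Option α),
    J = {z | ∃ e ∈ I, ∃ x ∈ L e, z = conv e x} := ⟨_, rfl⟩
  rw [← hJdef] at hJ
  have hfiber : ∀ e x, x ∈ fiber J e ↔ e ∈ I ∧ x ∈ L e := by
    intro e x
    subst hJdef
    constructor
    · rintro ⟨e', he', x', hx', h⟩
      obtain ⟨rfl, rfl⟩ := conv_injective h
      exact ⟨he', hx'⟩
    · rintro ⟨he, hx⟩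
      exact ⟨e, he, x, hx, rfl⟩
  obtain ⟨c₁, hshort⟩ := exists_short_index hI hJ
  obtain ⟨C, hC⟩ := exists_checker hI hJ
  obtain ⟨e₀, he₀⟩ : ∃ e₀ : List β, ∀ e ∈ I, e₀ ∈ I := by
    by_cases h : ∃ e, e ∈ I
    · obtain ⟨e, he⟩ := h
      exact ⟨e, fun _ _ => he⟩
    · exact ⟨[], fun e he => absurd ⟨e, he⟩ h⟩
  -- A code of an index `d` takes `d.length + 1` cells, as the digit string has to be ended.
  let c := c₁ + 1 + e₀.length
  refine ⟨machine C c e₀, 8 * c + 18, fun w => ?_⟩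
  obtain ⟨r, hr, hconj⟩ := exists_run (c := c) hC (by omega) e₀ (by omega) w
  refine ⟨r, hr, fun e he hw => ⟨fun n => ?_, ?_⟩⟩
  · rw [hconj, Stage.conjecture]
    split_ifs with h
    · exact h
    · exact he₀ e he
  · obtain ⟨s, hs, htell⟩ := exists_tellTale I L hne U m₀ hU e he
    obtain ⟨x₀, hx₀⟩ := hne e he
    obtain ⟨d, hd, hde, hspace⟩ := exists_index_of_space hshort e he w fun y hy =>
      (hw y).1 ((hfiber e y).1 hy).2
    have hmem : ∀ y, y ∈ fiber J d ↔ y ∈ L e := fun y => by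
      rw [hde, hfiber]
      exact and_iff_right he
    obtain ⟨h, n₁, hh, hn₁⟩ := Stage.hyp_converges J c e₀ w d (x₀ :: s)
      (fun y => (hmem y).trans (hw y))
      (fun y hy => (hmem y).2 (by
        rcases List.mem_cons.1 hy with rfl | hy
        exacts [hx₀, hs y hy]))
      (fun d' hd' hlt => by
        -- The word `x₀` makes sure that `d'` is an index.
        have hI' := ((hfiber d' x₀).1 (hd' x₀ List.mem_cons_self)).1
        have heq := htell d' hI'
          (fun y hy => ((hfiber d' y).1 (hd' y (List.mem_cons_of_mem _ hy))).2)
          (fun y hy => (hmem y).1 (hlt.1 ((hfiber d' y).2 ⟨hI', hy⟩)))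
        refine hlt.2 fun y hy => (hfiber d' y).2 ⟨hI', ?_⟩
        rw [heq]
        exact (hmem y).1 hy)
      (hspace.mono fun n hn => by
        rw [Stage.length_cells_run J c e₀ w (by omega)]
        omega)
    have hhI : h ∈ I := ((hfiber h x₀).1 (by rw [hh]; exact (hmem x₀).2 hx₀)).1
    have hLh : L h = L e := by
      ext y
      rw [← hmem, ← hh, hfiber]
      exact (and_iff_right hhI).symm
    have hval : ∀ n ≥ n₁, r.conjecture n = h := fun n hn => by
      rw [hconj, Stage.conjecture, hn₁ (n + 1) (by omega), if_pos hhI]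
    exact ⟨n₁, by rwa [hval n₁ le_rfl], by rw [hval n₁ le_rfl, hLh], fun k hk => by
      rw [hval k hk, hval n₁ le_rfl]⟩
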